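/- Let $\mathbb{K}$ be a field of characteristic $\neq 2$. A quadratic space is a finite-dimensional $\mathbb{K}$-vector space with a nondegenerate symmetric bilinear form $\langle\cdot,\cdot\rangle$; it has maximal Witt index if it contains a totally isotropic subspace of dimension $\lfloor \dim V/2\rfloor$ (this is automatic if $\mathbb{K}$ is algebraically closed). For a quadratic space $V$ and $k\ge 0$ let $$\hat{Gr}_{\mathrm{iso}}(k,V)=\{v_1\wedge\cdots\wedge v_k \mid v_1,\dots,v_k\in V,\ \langle v_i,v_j\rangle=0 \text{ for all } i,j\}\subseteq \textstyle\bigwedge^k V$$ be the isotropic Grassmann cone, and let $Gr_{\mathrm{iso}}(k,V)\subseteq\mathbb{P}(\bigwedge^kV)$ be the set of points represented by its nonzero elements. A linear map $\Phi:\bigwedge^kV\to\bigwedge^qW$ is isotropic Grassmann cone preserving (IGCP) if $\Phi(\hat{Gr}_{\mathrm{iso}}(k,V))\subseteq\hat{Gr}_{\mathrm{iso}}(q,W)$. A set $S$ of homogeneous polynomials on a vector space defines a subset of its projective space set-theoretically if that subset is the common zero locus of $S$. Assume that $\mathbb{K}$ is algebraically closed or, more generally, that all quadratic spaces below have maximal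 Witt index. Let $V$ be a quadratic space and $p=\lfloor\dim V/2\rfloor$. Let $q=3$ and $W$ be any quadratic space of dimension $7$ if $\dim V$ is odd, and let $q=4$ and $W$ be any quadratic space of dimension $8$ if $\dim V$ is even. Then: 1. If $p\ge1$, a form $\omega\in\bigwedge^pV$ lies in $\hat{Gr}_{\mathrm{iso}}(p,V)$ if and only if $\Phi(\omega)\in\hat{Gr}_{\mathrm{iso}}(q,W)$ for every IGCP map $\Phi:\bigwedge^pV\to\bigwedge^qW$. 2. $Gr_{\mathrm{iso}}(q,W)$ is defined set-theoretically by the homogeneous polynomials on $\bigwedge^qW$ that vanish on it; and whenever a set $S$ of homogeneous polynomials defines $Gr_{\mathrm{iso}}(q,W)$ set-theoretically, the pullbacks $f\circ\Phi$, with $f\in S$ and $\Phi:\bigwedge^pV\to\bigwedge^qW$ an IGCP map, define $Gr_{\mathrm{iso}}(p,V)$ set-theoretically. -/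

import Mathlib

open scoped LinearAlgebra.Projectivization

namespace IsoGr

section Cones

variable {K V W : Type*} [Field K] [AddCommGroup V] [Module K V] [AddCommGroup W] [Module K W]

/-- A subspace `L` is isotropic for `B` if `B` vanishes identically on `L`. -/
def IsIsotropic (B : LinearMap.BilinForm K V) (L : Submodule K V) : Prop :=
  ∀ u ∈ L, ∀ v ∈ L, B u v = 0

/-- The Witt index attains its upper bound `⌊dim V / 2⌋`: there is an isotropic subspace of that
dimension. -/
def HasMaximalWittIndex (B : LinearMap.BilinForm K V) : Prop :=
  ∃ L : Submodule K V, IsIsotropic B L ∧ Module.finrank K L = Module.finrank K V / 2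

/-- The isotropic Grassmann cone: all `v₁ ∧ ⋯ ∧ v_k` with `⟨v_i, v_j⟩ = 0` for all `i, j`. -/
def cone (B : LinearMap.BilinForm K V) (k : ℕ) : Set (⋀[K]^k V) :=
  {ω | ∃ v : Fin k → V, (∀ i j, B (v i) (v j) = 0) ∧ exteriorPower.ιMulti K k v = ω}

/-- Isotropic Grassmann cone preserving linear maps. -/
def IsIGCP (BV : LinearMap.BilinForm K V) (BW : LinearMap.BilinForm K W) {k q : ℕ}
    (Φ : ⋀[K]^k V →ₗ[K] ⋀[K]^q W) : Prop :=
  ∀ ω ∈ cone BV k, Φ ω ∈ cone BW q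

/-- The isotropic Grassmannian in its Plücker embedding: the projectivization of the cone. -/
def grassmannian (B : LinearMap.BilinForm K V) (k : ℕ) : Set (ℙ K (⋀[K]^k V)) :=
  {x | ∃ ω ∈ cone B k, ∃ h : ω ≠ 0, Projectivization.mk K ω h = x}

end Cones

section Equations

variable {K E F : Type*} [Field K] [AddCommGroup E] [Module K E] [AddCommGroup F] [Module K F]

/-- The value at `x` of a polynomial in linear forms on `E`. Polynomials on `E` are written without
a choice of coordinates, as polynomials whose variables are the linear forms on `E`. -/
noncomputable def evalAt (f : MvPolynomial (Module.Dual K E) K) (x : E) : K :=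
  MvPolynomial.eval (fun l : Module.Dual K E => l x) f

/-- The pullback of a polynomial along a linear map: substitute `l ∘ Φ` for every linear form
`l`. -/
noncomputable def pullback (Φ : E →ₗ[K] F) (f : MvPolynomial (Module.Dual K F) K) :
    MvPolynomial (Module.Dual K E) K :=
  MvPolynomial.rename (fun l : Module.Dual K F => l ∘ₗ Φ) f

theorem evalAt_pullback (Φ : E →ₗ[K] F) (f : MvPolynomial (Module.Dual K F) K) (x : E) :
    evalAt (pullback Φ f) x = evalAt f (Φ x) := by
  simp only [evalAt, pullback, MvPolynomial.eval_rename]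
  rfl

/-- `f` vanishes at the point `x` of projective space: it vanishes at all vectors representing
`x`. -/
def VanishesAt (f : MvPolynomial (Module.Dual K E) K) (x : ℙ K E) : Prop :=
  ∀ (v : E) (hv : v ≠ 0), Projectivization.mk K v hv = x → evalAt f v = 0

/-- The set `X` is defined set-theoretically by the equations in `S`: these are homogeneous and `X`
is their common zero locus. -/
def IsDefinedBy (X : Set (ℙ K E)) (S : Set (MvPolynomial (Module.Dual K E) K)) : Prop :=
  (∀ f ∈ S, ∃ d : ℕ, f.IsHomogeneous d) ∧ X = {x | ∀ f ∈ S, VanishesAt f x}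

/-- All homogeneous polynomials that vanish on `X`. -/
def equations (X : Set (ℙ K E)) : Set (MvPolynomial (Module.Dual K E) K) :=
  {f | (∃ d : ℕ, f.IsHomogeneous d) ∧ ∀ x ∈ X, VanishesAt f x}

end Equations

/-- The pullbacks of the polynomials in `S` along all isotropic Grassmann cone preserving maps
`⋀^k V → ⋀^q W`. -/
def pullbacks {K V W : Type*} [Field K] [AddCommGroup V] [Module K V]
    [AddCommGroup W] [Module K W]
    (BV : LinearMap.BilinForm K V) (BW : LinearMap.BilinForm K W) (k : ℕ) {q : ℕ}
    (S : Set (MvPolynomial (Module.Dual K (⋀[K]^q W)) K)) :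
    Set (MvPolynomial (Module.Dual K (⋀[K]^k V)) K) :=
  {g | ∃ Φ : ⋀[K]^k V →ₗ[K] ⋀[K]^q W, IsIGCP BV BW Φ ∧ ∃ f ∈ S, g = pullback Φ f}

end IsoGr

open scoped LinearAlgebra.Projectivization

namespace IsoGr

open Module Function

/-! ### Multivectors as alternating forms -/

section Forms

variable {K V : Type*} [Field K] [AddCommGroup V] [Module K V]

/-! The bilinear form identifies `⋀^k V` with alternating `k`-forms (`toForm_bijective`). The
detection of the cone by cone preserving maps is then proved by induction on `p`.

For an isotropic vector `e` in a hyperbolic pair `(e, f)`, contraction with `e` followed by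
projection to the complement of `e` and `f` preserves the cones, and so does multiplication by `f`;
contraction inverts multiplication (`HypPair.exists_contract_wedge`). For `p ≤ q`, iterating this
makes `⋀^p V` a retract of `⋀^q W` through cone preserving maps (`exists_isIGCPRetract`), so a
single map detects the cone.

For `p > q`, the induction hypothesis applies to every contraction of `ω`. Hence for every isotropic
`e ≠ 0` the form of `ω` agrees with a pure isotropic form on the tuples in the orthogonal complement
of `e` that contain `e` (`PureAlong`). It remains to glue these local pure forms. If `ω` vanishes
along every isotropic vector, it is zero by evaluation on a hyperbolic basis
(`Hyperbolic.eq_zero_even`, `Hyperbolic.eq_zero_odd`). Otherwise `ω` takes the value `1` on some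
isotropic tuple `t`. The one-slot functionals `v ↦ ω (update t i v)` are represented by vectors `f
i`, which form an isotropic tuple dual to `t`, and `ω` agrees with the form of `f 0 ∧ ⋯ ∧ f (p - 1)`
along enough isotropic vectors (`exists_hyperbolic_agree`) for the difference to vanish by the same
evaluation. Comparing the forms along a vector obtained by altering `m` entries of `t` takes `p ≥ m
+ 3`. One entry suffices in odd dimension and two are needed in even dimension, whence `p ≥ 4` and
`p ≥ 5`, and the base cases `q = 3` and `q = 4`.

For the equations, Plücker-type and isotropy polynomials cut out the cone
(`mem_cone_of_evalAt_eq_zero`), and pulling back equations turns the detection statement into the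
second part (`isDefinedBy_pullbacks`). -/

/-- The alternating form `v ↦ ⟨ω, v₁ ∧ ⋯ ∧ v_k⟩` attached to `ω ∈ ⋀^k V` by a bilinear form. -/
noncomputable def toForm (B : LinearMap.BilinForm K V) (k : ℕ) :
    ⋀[K]^k V →ₗ[K] (V [⋀^Fin k]→ₗ[K] K) :=
  exteriorPower.alternatingMapLinearEquiv.symm.toLinearMap ∘ₗ
    exteriorPower.pairingDual K V k ∘ₗ exteriorPower.map k B

theorem toForm_ιMulti (B : LinearMap.BilinForm K V) {k : ℕ} (u v : Fin k → V) :
    toForm B k (exteriorPower.ιMulti K k u) v = (Matrix.of fun i j => B (u i) (v j)).det := by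
  rw [← Matrix.det_transpose]
  simp only [toForm, LinearMap.comp_apply, LinearEquiv.coe_coe, exteriorPower.map_apply_ιMulti,
    exteriorPower.alternatingMapLinearEquiv_symm_apply]
  exact exteriorPower.pairingDual_ιMulti_ιMulti _ _

theorem toForm_eq_pairingDual {B : LinearMap.BilinForm K V} (hs : B.IsSymm) {k : ℕ}
    (ω : ⋀[K]^k V) (v : Fin k → V) :
    toForm B k ω v =
      exteriorPower.pairingDual K V k (exteriorPower.ιMulti K k (fun i => B (v i))) ω := by
  let φ : ⋀[K]^k V →ₗ[K] K :=
    { toFun := fun ω => toForm B k ω v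
      map_add' := by intros; simp
      map_smul' := by intros; simp }
  suffices h : φ =
      exteriorPower.pairingDual K V k (exteriorPower.ιMulti K k (fun i => B (v i))) from
    LinearMap.congr_fun h ω
  apply exteriorPower.linearMap_ext
  ext u
  simp only [LinearMap.compAlternatingMap_apply, exteriorPower.pairingDual_ιMulti_ιMulti]
  refine (toForm_ιMulti B u v).trans ?_
  congr 1
  ext i j
  exact (hs.eq (v j) (u i)).symm

variable [FiniteDimensional K V]

/-- The coordinates of `ω` in the basis of `⋀^k V` induced by `b` are values of its form at the
vectors that represent the coordinate functionals of `b` through `B`. -/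
theorem toForm_injective {B : LinearMap.BilinForm K V} (hs : B.IsSymm) (hn : B.Nondegenerate)
    (k : ℕ) : Injective (toForm B k) := by
  rw [injective_iff_map_eq_zero]
  intro ω hω
  let b := Module.finBasis K V
  apply (b.exteriorPower k).repr.injective
  ext s
  rw [exteriorPower.basis_repr_apply, map_zero, Finsupp.zero_apply, exteriorPower.ιMultiDual,
    exteriorPower.ιMulti_family]
  have := toForm_eq_pairingDual hs ω
    (fun i => (B.toDual hn).symm (b.coord (Set.powersetCard.ofFinEmbEquiv.symm s i)))
  rw [hω] at this
  refine Eq.trans ?_ this.symm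
  congr 3
  ext i x
  exact (LinearMap.BilinForm.apply_toDual_symm_apply _ _).symm

theorem toForm_bijective {B : LinearMap.BilinForm K V} (hs : B.IsSymm) (hn : B.Nondegenerate)
    (k : ℕ) : Bijective (toForm B k) := by
  have hi := toForm_injective hs hn k
  refine ⟨hi, ?_⟩
  have e := (exteriorPower.alternatingMapLinearEquiv (R := K) (M := V) (N := K) (n := k))
  have : FiniteDimensional K (V [⋀^Fin k]→ₗ[K] K) := e.symm.finiteDimensional
  refine (LinearMap.injective_iff_surjective_of_finrank_eq_finrank ?_).1 hi
  rw [e.finrank_eq]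
  exact Subspace.dual_finrank_eq.symm

end Forms

/-! ### Dual isotropic tuples -/

section Tuples

variable {K V : Type*} [Field K] [AddCommGroup V] [Module K V]

/-- A tuple of vectors that are isotropic and pairwise orthogonal. -/
def IsoTuple (B : LinearMap.BilinForm K V) {ι : Type*} (u : ι → V) : Prop :=
  ∀ i j, B (u i) (u j) = 0

/-- Two tuples are dual to each other with respect to `B`. -/
def DualTuples (B : LinearMap.BilinForm K V) {ι : Type*} [DecidableEq ι] (u w : ι → V) : Prop :=
  ∀ i j, B (u i) (w j) = if i = j then 1 else 0

/-- Any dual tuple `w'` can be made isotropic without losing duality: since the span of `u` is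
isotropic, subtracting half of the Gram matrix of `w'`, with coefficients on `u`, cancels all the
products. -/
theorem exists_dualTuple [FiniteDimensional K V] {B : LinearMap.BilinForm K V} (hs : B.IsSymm)
    (hn : B.Nondegenerate) (h2 : (2 : K) ≠ 0) {ι : Type*} [Fintype ι] [DecidableEq ι] {u : ι → V}
    (hu : IsoTuple B u) (hli : LinearIndependent K u) :
    ∃ w : ι → V, IsoTuple B w ∧ DualTuples B u w := by
  have h1 : ∀ j, ∃ w : V, ∀ i, B (u i) w = if i = j then 1 else 0 := by
    intro j
    obtain ⟨φ, hφ⟩ := LinearMap.exists_extend ((Basis.span hli).coord j)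
    refine ⟨(B.toDual hn).symm φ, fun i => ?_⟩
    have h : B (u i) ((B.toDual hn).symm φ) = φ (u i) :=
      (hs.eq _ _).symm.trans (LinearMap.BilinForm.apply_toDual_symm_apply _ _)
    have h' := LinearMap.congr_fun hφ (Basis.span hli i)
    rw [LinearMap.comp_apply, Submodule.subtype_apply, Basis.coord_apply, Basis.repr_self,
      Finsupp.single_apply, Basis.span_apply] at h'
    exact h.trans h'
  choose w' hw' using h1
  refine ⟨fun j => w' j - (2 : K)⁻¹ • ∑ k, B (w' j) (w' k) • u k, fun i j => ?_, fun i j => ?_⟩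
  · have h3 : ∀ i j, B (w' i) (u j) = if j = i then 1 else 0 := fun i j => by
      rw [← hw' i j]; exact hs.eq _ _
    have h4 : B (w' i) (w' j) = B (w' j) (w' i) := hs.eq _ _
    have h5 : ∀ i j, B (u i) (u j) = 0 := hu
    simp [map_sum, h3, hw', h5, h4]
    field_simp
    ring
  · have h5 : ∀ i j, B (u i) (u j) = 0 := hu
    simp [map_sum, hw', h5]

theorem DualTuples.linearIndependent {B : LinearMap.BilinForm K V} {ι : Type*} [Fintype ι]
    [DecidableEq ι] {u w : ι → V} (h : DualTuples B u w) : LinearIndependent K u := by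
  rw [Fintype.linearIndependent_iff]
  intro c hc i
  have := congrArg (fun x => B x (w i)) hc
  have h' : ∀ i j, B (u i) (w j) = if i = j then 1 else 0 := h
  simpa [map_sum, LinearMap.sum_apply, h'] using this

end Tuples

/-! ### Agreement of forms along an isotropic vector -/

section Agreement

variable {K V : Type*} [Field K] [AddCommGroup V] [Module K V]

theorem DualTuples.toForm_update {B : LinearMap.BilinForm K V} {k : ℕ} {f t : Fin k → V}
    (h : DualTuples B f t) (i : Fin k) (v : V) :
    toForm B k (exteriorPower.ιMulti K k f) (update t i v) = B (f i) v := by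
  rw [toForm_ιMulti]
  have : (Matrix.of fun r j => B (f r) (update t i v j)) =
      (1 : Matrix (Fin k) (Fin k) K).updateCol i (fun r => B (f r) v) := by
    ext r j
    rcases eq_or_ne j i with rfl | hj
    · simp
    · simp [hj, h r j, Matrix.one_apply]
  rw [this, ← Matrix.cramer_apply, Matrix.cramer_one]
  rfl

/-- The matrix of products of `y` with `t` is invertible. Its inverse applied to `y` gives `z`,
which only rescales the wedge product by the determinant. -/
theorem exists_dualTuples_of_toForm_ne_zero {B : LinearMap.BilinForm K V} {k : ℕ}
    {y t : Fin k → V} (hy : IsoTuple B y) (h : toForm B k (exteriorPower.ιMulti K k y) t ≠ 0) :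
    ∃ z : Fin k → V, IsoTuple B z ∧ DualTuples B z t ∧ toForm B k (exteriorPower.ιMulti K k y) =
      toForm B k (exteriorPower.ιMulti K k y) t • toForm B k (exteriorPower.ιMulti K k z) := by
  rw [toForm_ιMulti] at h ⊢
  set M : Matrix (Fin k) (Fin k) K := Matrix.of fun i j => B (y i) (t j) with hM
  have hMu : IsUnit M.det := h.isUnit
  have key : ∀ v : Fin k → V, (Matrix.of fun i j => B (∑ a, M⁻¹ i a • y a) (v j)) =
      M⁻¹ * Matrix.of fun i j => B (y i) (v j) := by
    intro v
    ext i j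
    simp [Matrix.mul_apply, LinearMap.sum_apply]
  refine ⟨fun i => ∑ a, M⁻¹ i a • y a, fun i j => ?_, fun i j => ?_, ?_⟩
  · have : ∀ a b, B (y a) (y b) = 0 := hy
    simp [LinearMap.sum_apply, this]
  · have := congrFun (congrFun (key t) i) j
    rw [Matrix.nonsing_inv_mul _ hMu] at this
    simpa [Matrix.one_apply] using this
  · ext v
    rw [AlternatingMap.smul_apply, toForm_ιMulti, toForm_ιMulti, key, Matrix.det_mul,
      Matrix.det_nonsing_inv, Ring.inverse_eq_inv', smul_eq_mul, mul_inv_cancel_left₀ h]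

/-- `η` vanishes on all tuples of vectors orthogonal to `e` that contain `e`. -/
def VanishesAlong (B : LinearMap.BilinForm K V) {k : ℕ} (η : V [⋀^Fin k]→ₗ[K] K) (e : V) : Prop :=
  ∀ (v : Fin k → V) (i : Fin k), v i = e → (∀ j, B e (v j) = 0) → η v = 0

/-- On tuples of vectors orthogonal to `e` that contain `e`, the form `ω` coincides with the form of
an element of the isotropic Grassmann cone. -/
def PureAlong (B : LinearMap.BilinForm K V) {k : ℕ} (ω : V [⋀^Fin k]→ₗ[K] K) (e : V) : Prop :=
  ∃ y : Fin k → V, IsoTuple B y ∧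
    VanishesAlong B (ω - toForm B k (exteriorPower.ιMulti K k y)) e

theorem vanishesAlong_of_slot {B : LinearMap.BilinForm K V} {k : ℕ} {η : V [⋀^Fin k]→ₗ[K] K}
    {e : V} (i : Fin k) (h : ∀ v : Fin k → V, v i = e → (∀ j, B e (v j) = 0) → η v = 0) :
    VanishesAlong B η e := by
  intro v j hj hv
  rcases eq_or_ne i j with rfl | hij
  · exact h v hj hv
  · have := h (v ∘ Equiv.swap i j) (by simpa using hj) (fun l => hv _)
    rwa [η.map_swap v hij, neg_eq_zero] at this

theorem orthogonal_update {B : LinearMap.BilinForm K V} {k : ℕ} {s : Fin k → V} {e v : V}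
    (hs : ∀ j, B e (s j) = 0) (hv : B e v = 0) (i : Fin k) : ∀ j, B e (update s i v j) = 0 := by
  intro j
  rcases eq_or_ne j i with rfl | hj
  · simpa using hv
  · simpa [hj] using hs j

/-- The pure form that describes `ω` along `e` can be read off from the values of `ω`. -/
theorem PureAlong.exists_dualTuples {B : LinearMap.BilinForm K V} {k : ℕ}
    {ω : V [⋀^Fin k]→ₗ[K] K} {e : V} (h : PureAlong B ω e) {s : Fin k → V} {i : Fin k}
    (hi : s i = e) (hs : ∀ j, B e (s j) = 0) (h1 : ω s = 1) :
    ∃ z : Fin k → V, IsoTuple B z ∧ DualTuples B z s ∧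
      VanishesAlong B (ω - toForm B k (exteriorPower.ιMulti K k z)) e ∧
      ∀ j, j ≠ i → ∀ v, B e v = 0 → B (z j) v = ω (update s j v) := by
  obtain ⟨y, hy, hv⟩ := h
  have h2 : toForm B k (exteriorPower.ιMulti K k y) s = 1 := by
    have := hv s i hi hs
    rw [AlternatingMap.sub_apply, sub_eq_zero] at this
    rw [← this, h1]
  obtain ⟨z, hz, hd, hzy⟩ := exists_dualTuples_of_toForm_ne_zero hy (h2.trans_ne one_ne_zero)
  rw [hzy, h2, one_smul] at hv
  refine ⟨z, hz, hd, hv, fun j hj v hve => ?_⟩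
  rw [← hd.toForm_update j v]
  have := hv (update s j v) i (by simpa [hj.symm] using hi) (orthogonal_update hs hve j)
  rw [AlternatingMap.sub_apply, sub_eq_zero] at this
  exact this.symm

theorem det_eq_of_column_single {k : ℕ} {M N : Matrix (Fin k) (Fin k) K} (i : Fin k)
    (hM : ∀ r, M r i = if r = i then 1 else 0) (hN : ∀ r, N r i = if r = i then 1 else 0)
    (h : ∀ r, r ≠ i → ∀ j, M r j = N r j) : M.det = N.det := by
  obtain _ | k := k
  · exact i.elim0
  rw [Matrix.det_succ_column M i, Matrix.det_succ_column N i]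
  refine Finset.sum_congr rfl fun r _ => ?_
  rw [hM, hN]
  split_ifs with hr
  · subst hr
    congr 2
    ext a b
    exact h _ (Fin.succAbove_ne _ _) _
  · simp

/-- A uniqueness principle: expanding the determinants along the column of `e`, the pure forms
depend on `e`-orthogonal arguments only through the rows `j ≠ i`, and these rows are one-slot values
of the forms at `s`. So agreement along `e` need only be checked on `s` and on its one-entry
changes. -/
theorem PureAlong.vanishesAlong_sub {B : LinearMap.BilinForm K V} {k : ℕ}
    {ω ω' : V [⋀^Fin k]→ₗ[K] K} {e : V} (h : PureAlong B ω e) (h' : PureAlong B ω' e)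
    {s : Fin k → V} {i : Fin k} (hi : s i = e) (hs : ∀ j, B e (s j) = 0) (h1 : ω' s = 1)
    (h2 : (ω - ω') s = 0)
    (h3 : ∀ j, j ≠ i → ∀ v, B e v = 0 → (ω - ω') (update s j v) = 0) :
    VanishesAlong B (ω - ω') e := by
  rw [AlternatingMap.sub_apply, sub_eq_zero] at h2
  obtain ⟨z, -, hd, hv, hz⟩ := h.exists_dualTuples hi hs (h2.trans h1)
  obtain ⟨z', -, hd', hv', hz'⟩ := h'.exists_dualTuples hi hs h1
  refine vanishesAlong_of_slot i fun v hvi hve => ?_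
  have a := hv v i hvi hve
  have a' := hv' v i hvi hve
  rw [AlternatingMap.sub_apply, sub_eq_zero] at a a' ⊢
  rw [a, a', toForm_ιMulti, toForm_ιMulti]
  refine det_eq_of_column_single i (fun r => ?_) (fun r => ?_) (fun r hr j => ?_)
  · have := hd r i
    rwa [hi, ← hvi] at this
  · have := hd' r i
    rwa [hi, ← hvi] at this
  · have := h3 r hr (v j) (hve j)
    rw [AlternatingMap.sub_apply, sub_eq_zero] at this
    simp only [Matrix.of_apply]
    rw [hz r hr _ (hve j), hz' r hr _ (hve j), this]

/-- A form that vanishes along two vectors `x` and `y` vanishes on every tuple that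
contains them and is orthogonal to them up to one entry. -/
theorem VanishesAlong.eq_zero_of_two {B : LinearMap.BilinForm K V} {k : ℕ}
    {η : V [⋀^Fin k]→ₗ[K] K} {x y f : V} (hx : VanishesAlong B η x) (hy : VanishesAlong B η y)
    (hxf : B x f = 1) (hyf : B y f = 0) {z : Fin k → V} {i a b : Fin k} (ha : z a = x)
    (hb : z b = y) (hai : a ≠ i) (hbi : b ≠ i) (hzx : ∀ j, j ≠ i → B x (z j) = 0)
    (hzy : ∀ j, j ≠ i → B y (z j) = 0) : η z = 0 := by
  -- The entry `z i` splits into a summand orthogonal to `x` and a multiple of `f`, which is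
  -- orthogonal to `y`; vanishing along `x` and along `y` treat one summand each.
  have e1 : z = update z i ((z i - B x (z i) • f) + B x (z i) • f) := by simp
  rw [e1, η.map_update_add]
  have aux : ∀ (w c : V), B c w = 0 → (∀ j, j ≠ i → B c (z j) = 0) →
      ∀ j, B c (update z i w j) = 0 := by
    intro w c hw hc j
    rcases eq_or_ne j i with rfl | hj
    · simpa using hw
    · simpa [hj] using hc j hj
  rw [hx _ a (by simpa [hai] using ha) (aux _ x (by simp [hxf]) hzx),
    hy _ b (by simpa [hbi] using hb) (aux _ y (by simp [hyf]) hzy), add_zero]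

end Agreement

/-! ### Freezing all but two arguments -/

section Pairs

variable {K V : Type*} [Field K] [AddCommGroup V] [Module K V]

/-- The bilinear form obtained from an alternating form by fixing all but two arguments. -/
def pairEval {k : ℕ} (η : V [⋀^Fin k]→ₗ[K] K) (v : Fin k → V) {a b : Fin k} (hab : a ≠ b) :
    V →ₗ[K] V →ₗ[K] K :=
  LinearMap.mk₂ K (fun x y => η (update (update v a x) b y))
    (fun x x' y => by simp only [update_comm hab, η.map_update_add])
    (fun c x y => by simp only [update_comm hab, η.map_update_smul])
    (fun x y y' => η.map_update_add _ _ _ _)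
    (fun c x y => η.map_update_smul _ _ _ _)

theorem pairEval_apply {k : ℕ} (η : V [⋀^Fin k]→ₗ[K] K) (v : Fin k → V) {a b : Fin k} (hab : a ≠ b)
    (x y : V) : pairEval η v hab x y = η (update (update v a x) b y) := rfl

theorem pairEval_self {k : ℕ} (η : V [⋀^Fin k]→ₗ[K] K) (v : Fin k → V) {a b : Fin k} (hab : a ≠ b)
    (x : V) : pairEval η v hab x x = 0 := by
  rw [pairEval_apply]
  exact η.map_eq_zero_of_eq _ (i := a) (j := b) (by simp [hab]) hab

theorem pairEval_swap {k : ℕ} (η : V [⋀^Fin k]→ₗ[K] K) (v : Fin k → V) {a b : Fin k} (hab : a ≠ b)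
    (x y : V) : pairEval η v hab x y = - pairEval η v hab y x := by
  have h := pairEval_self η v hab (x + y)
  simp only [map_add, LinearMap.add_apply, pairEval_self] at h
  linear_combination h

theorem pairEval_eq {k : ℕ} (η : V [⋀^Fin k]→ₗ[K] K) (v : Fin k → V) {a b : Fin k} (hab : a ≠ b) :
    pairEval η v hab (v a) (v b) = η v := by
  simp [pairEval_apply]

theorem VanishesAlong.update_eq_zero {B : LinearMap.BilinForm K V} {k : ℕ} {η : V [⋀^Fin k]→ₗ[K] K}
    {e : V} (h : VanishesAlong B η e) (he : B e e = 0) {v : Fin k → V} {a : Fin k}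
    (hv : ∀ j, j ≠ a → B e (v j) = 0) : η (update v a e) = 0 := by
  refine h _ a (by simp) fun j => ?_
  rcases eq_or_ne j a with rfl | hj
  · simpa using he
  · simpa [hj] using hv j hj

theorem VanishesAlong.pairEval_eq_zero {B : LinearMap.BilinForm K V} {k : ℕ}
    {η : V [⋀^Fin k]→ₗ[K] K} {e : V} (h : VanishesAlong B η e) (he : B e e = 0) {v : Fin k → V}
    {a b : Fin k} (hab : a ≠ b) (hv : ∀ j, j ≠ a → j ≠ b → B e (v j) = 0) {y : V}
    (hy : B e y = 0) : pairEval η v hab e y = 0 := by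
  rw [pairEval_apply, update_comm hab]
  refine h.update_eq_zero he fun j hj => ?_
  rcases eq_or_ne j b with rfl | hjb
  · simpa using hy
  · simpa [hjb] using hv j hj hjb

end Pairs

/-! ### Forms vanishing along enough isotropic vectors are zero -/

section Hyperbolic

variable {K V : Type*} [Field K] [AddCommGroup V] [Module K V]

/-- A pair of totally isotropic tuples that are dual to each other. -/
structure Hyperbolic (B : LinearMap.BilinForm K V) {ι : Type*} [DecidableEq ι] (e f : ι → V) :
    Prop where
  left : IsoTuple B e
  right : IsoTuple B f
  dual : DualTuples B e f

variable {B : LinearMap.BilinForm K V} {p : ℕ} {e f : Fin p → V}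

theorem Hyperbolic.apply_flip (h : Hyperbolic B e f) (hs : B.IsSymm) (i j : Fin p) :
    B (f i) (e j) = if i = j then 1 else 0 := by
  have : B (f i) (e j) = B (e j) (f i) := hs.eq _ _
  rw [this, h.dual j i]
  simp only [eq_comm]

theorem Hyperbolic.linearIndependent (h : Hyperbolic B e f) (hs : B.IsSymm) :
    LinearIndependent K (Sum.elim e f) := by
  have : DualTuples B (Sum.elim e f) (Sum.elim f e) := by
    rintro (i | i) (j | j)
    · simpa using h.dual i j
    · simpa using h.left i j
    · simpa using h.right i j
    · simpa using h.apply_flip hs i j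
  exact this.linearIndependent

theorem Hyperbolic.linearIndependent_snoc (h : Hyperbolic B e f) (hs : B.IsSymm) {g : V}
    (hg : B g g ≠ 0) (hge : ∀ i, B g (e i) = 0) (hgf : ∀ i, B g (f i) = 0) :
    LinearIndependent K (Sum.elim (Sum.elim e f) (fun _ : Unit => g)) := by
  have hs' : ∀ x y, B x y = B y x := hs.eq
  have : DualTuples B (Sum.elim (Sum.elim e f) (fun _ : Unit => g))
      (Sum.elim (Sum.elim f e) (fun _ : Unit => (B g g)⁻¹ • g)) := by
    rintro ((i | i) | i) ((j | j) | j)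
    · simpa using h.dual i j
    · simpa using h.left i j
    · simp [hs' (e i) g, hge]
    · simpa using h.right i j
    · simpa using h.apply_flip hs i j
    · simp [hs' (f i) g, hgf]
    · simp [hgf]
    · simp [hge]
    · simp [hg]
  exact this.linearIndependent

/-- Write `[x, y]` for the two-argument form. The pair `e i + e j`, `f i - f j` gives `[e i, f i] =
[e j, f j]`, and the pairs `e i ± f j`, `f i ∓ e j` give `[e i, f i] = -[e j, f j]` and `[f j, f i]
= [e i, e j] = 0`. Dividing by `2` finishes both claims. -/
theorem Hyperbolic.pairEval_even (h : Hyperbolic B e f) (hs : B.IsSymm) (h2 : (2 : K) ≠ 0)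
    {k : ℕ} {η : V [⋀^Fin k]→ₗ[K] K}
    (h1 : ∀ i, VanishesAlong B η (e i)) (hee : ∀ i j, i ≠ j → VanishesAlong B η (e i + e j))
    (hef : ∀ i j, i ≠ j → VanishesAlong B η (e i + f j))
    (hef' : ∀ i j, i ≠ j → VanishesAlong B η (e i - f j)) {i j : Fin p} (hij : i ≠ j)
    {v : Fin k → V} {a b : Fin k} (hab : a ≠ b)
    (hi : ∀ c, c ≠ a → c ≠ b → B (e i) (v c) = 0) (hj : ∀ c, c ≠ a → c ≠ b → B (e j) (v c) = 0)
    (hj' : ∀ c, c ≠ a → c ≠ b → B (f j) (v c) = 0) :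
    pairEval η v hab (e i) (f i) = 0 ∧ pairEval η v hab (f j) (f i) = 0 := by
  have l : ∀ i j, B (e i) (e j) = 0 := h.left
  have r : ∀ i j, B (f i) (f j) = 0 := h.right
  have d : ∀ i j, B (e i) (f j) = if i = j then 1 else 0 := h.dual
  have d' := h.apply_flip hs
  have q1 := (h1 i).pairEval_eq_zero (l i i) hab hi (l i j)
  have q2 := (h1 i).pairEval_eq_zero (l i i) hab hi (y := f j) (by simp [d, hij])
  have q3 := (h1 j).pairEval_eq_zero (l j j) hab hj (y := f i) (by simp [d, hij.symm])
  have q4 := (hee i j hij).pairEval_eq_zero (by simp [l]) (v := v) hab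
    (fun c hc hc' => by simp [hi c hc hc', hj c hc hc']) (y := f i - f j)
    (by simp [d, hij, hij.symm])
  have q5 := (hef i j hij).pairEval_eq_zero (by simp [l, r, d, d', hij, hij.symm]) (v := v) hab
    (fun c hc hc' => by simp [hi c hc hc', hj' c hc hc']) (y := f i - e j)
    (by simp [l, r, d, d'])
  have q6 := (hef' i j hij).pairEval_eq_zero (by simp [l, r, d, d', hij, hij.symm]) (v := v) hab
    (fun c hc hc' => by simp [hi c hc hc', hj' c hc hc']) (y := f i + e j)
    (by simp [l, r, d, d'])
  have q7 := pairEval_swap η v hab (e j) (f j)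
  simp only [map_add, map_sub, LinearMap.add_apply, LinearMap.sub_apply] at q4 q5 q6
  constructor
  · apply (mul_eq_zero_iff_left (mul_ne_zero h2 h2)).1
    linear_combination 2 * q4 + q5 + q6 + 2 * q2 - 2 * q3 + 2 * q7
  · apply (mul_eq_zero_iff_left h2).1
    linear_combination q5 - q6 + 2 * q1

/-- Evaluate on an injective tuple of hyperbolic basis vectors, according to which of `e i`, `f i`
occur for each index. An `e i` without `f i` is settled by vanishing along `e i`; the other patterns
follow from the vectors `e i ± f j` and `e i + e j`. -/
theorem Hyperbolic.eq_zero_even [FiniteDimensional K V] (h : Hyperbolic B e f) (hs : B.IsSymm)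
    (h2 : (2 : K) ≠ 0) (hd : finrank K V = 2 * p) (hp : 2 ≤ p) {η : V [⋀^Fin p]→ₗ[K] K}
    (h1 : ∀ i, VanishesAlong B η (e i)) (hee : ∀ i j, i ≠ j → VanishesAlong B η (e i + e j))
    (hef : ∀ i j, i ≠ j → VanishesAlong B η (e i + f j))
    (hef' : ∀ i j, i ≠ j → VanishesAlong B η (e i - f j)) : η = 0 := by
  have l : ∀ i j, B (e i) (e j) = 0 := h.left
  have r : ∀ i j, B (f i) (f j) = 0 := h.right
  have d : ∀ i j, B (e i) (f j) = if i = j then 1 else 0 := h.dual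
  have d' := h.apply_flip hs
  have : Nonempty (Fin p) := ⟨⟨0, by omega⟩⟩
  let bs := basisOfLinearIndependentOfCardEqFinrank (h.linearIndependent hs) (by simp [hd]; omega)
  have hbs : ⇑bs = Sum.elim e f := coe_basisOfLinearIndependentOfCardEqFinrank _ _
  refine bs.ext_alternating fun s hinj => ?_
  rw [hbs, AlternatingMap.zero_apply]
  set v : Fin p → V := fun c => Sum.elim e f (s c) with hv
  have oe : ∀ i c, s c ≠ Sum.inr i → B (e i) (v c) = 0 := by
    intro i c hc
    simp only [hv]
    rcases hsc : s c with m | m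
    · simp [l]
    · rw [Sum.elim_inr, d]
      rw [if_neg]; rintro rfl; exact hc hsc
  have of : ∀ i c, s c ≠ Sum.inl i → B (f i) (v c) = 0 := by
    intro i c hc
    simp only [hv]
    rcases hsc : s c with m | m
    · rw [Sum.elim_inl, d']
      rw [if_neg]; rintro rfl; exact hc hsc
    · simp [r]
  by_cases hA : ∃ i, (∃ c, s c = Sum.inl i) ∧ ∀ c, s c ≠ Sum.inr i
  · obtain ⟨i, ⟨c, hc⟩, hi⟩ := hA
    exact h1 i v c (by simp [hv, hc]) fun j => oe i j (hi j)
  push Not at hA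
  by_cases hB : ∃ i j, (∀ c, s c ≠ Sum.inl i) ∧ (∀ c, s c ≠ Sum.inr i) ∧
      (∃ c, s c = Sum.inr j) ∧ ∀ c, s c ≠ Sum.inl j
  · obtain ⟨i, j, hi, hi', ⟨c, hc⟩, hj⟩ := hB
    have hij : i ≠ j := by rintro rfl; exact hi' c hc
    have q1 := (h1 i).update_eq_zero (l i i) (v := v) (a := c) fun j _ => oe i j (hi' j)
    have q2 := (hef i j hij).update_eq_zero (by simp [l, r, d, d', hij, hij.symm]) (v := v) (a := c)
      fun m _ => by simp [oe i m (hi' m), of j m (hj m)]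
    rw [η.map_update_add, q1, zero_add] at q2
    rwa [show f j = v c by simp [hv, hc], update_eq_self] at q2
  push Not at hB
  -- No index is missing altogether now, so the tuple is a permutation of all the `f i`; the product
  -- `[f j, f i]` handles it, which takes two indices.
  by_cases hC : ∃ j, (∃ c, s c = Sum.inr j) ∧ ∀ c, s c ≠ Sum.inl j
  · obtain ⟨j, ⟨b, hb⟩, hj⟩ := hC
    have hall : ∀ i, ∃ c, s c = Sum.inr i := by
      intro i
      by_contra hcon
      push Not at hcon
      by_cases hi : ∃ c, s c = Sum.inl i
      · obtain ⟨c, hc⟩ := hA i hi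
        exact hcon c hc
      · push Not at hi
        obtain ⟨c, hc⟩ := hB i j hi hcon ⟨b, hb⟩
        exact hj c hc
    choose τ hτ using hall
    have hτi : Injective τ := fun x y hxy => by
      have := (hτ x).symm.trans ((congrArg s hxy).trans (hτ y))
      simpa using this
    have hτs := Finite.surjective_of_injective hτi
    have hse : ∀ c i, s c ≠ Sum.inl i := by
      intro c i hc
      obtain ⟨m, rfl⟩ := hτs c
      simp [hτ m] at hc
    obtain ⟨i, hij⟩ : ∃ i, i ≠ j := by
      have : Nontrivial (Fin p) := Fin.nontrivial_iff_two_le.2 hp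
      exact exists_ne j
    have hab : τ j ≠ τ i := fun h => hij (hτi h).symm
    have q := (h.pairEval_even hs h2 h1 hee hef hef' hij (v := v) hab
      (fun c _ hc => oe i c fun h => hc (hinj (h.trans (hτ i).symm)))
      (fun c hc _ => oe j c fun h => hc (hinj (h.trans (hτ j).symm)))
      (fun c _ _ => of j c (hse c j))).2
    rw [← pairEval_eq η v hab]
    simpa [hv, hτ] using q
  push Not at hC
  -- Here the indices occur only in complete pairs `e i`, `f i`. Since `p` entries cannot exhaust `2
  -- * p` basis vectors, some index `j` is absent and serves as the auxiliary index.
  obtain ⟨i, ⟨a, ha⟩, b, hb⟩ : ∃ i, (∃ c, s c = Sum.inl i) ∧ ∃ c, s c = Sum.inr i := by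
    rcases h0 : s (Classical.arbitrary _) with i | i
    · exact ⟨i, ⟨_, h0⟩, hA i ⟨_, h0⟩⟩
    · exact ⟨i, hC i ⟨_, h0⟩, ⟨_, h0⟩⟩
  obtain ⟨j, hj, hj'⟩ : ∃ j, (∀ c, s c ≠ Sum.inl j) ∧ ∀ c, s c ≠ Sum.inr j := by
    by_contra hcon
    push Not at hcon
    have hsur : Surjective s := by
      have : ∀ j, ∃ c, s c = Sum.inr j := fun j => by
        by_cases hj : ∃ c, s c = Sum.inl j
        · exact hA j hj
        · push Not at hj
          exact hcon j hj
      rintro (j | j)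
      · exact hC j (this j)
      · exact this j
    have := Fintype.card_le_of_surjective s hsur
    simp at this
    omega
  have hij : i ≠ j := by rintro rfl; exact hj a ha
  have hab : a ≠ b := by rintro rfl; simp [ha] at hb
  have q := (h.pairEval_even hs h2 h1 hee hef hef' hij (v := v) hab
      (fun c _ hc => oe i c fun h => hc (hinj (h.trans hb.symm)))
      (fun c hc _ => oe j c (hj' c)) (fun c _ _ => of j c (hj c))).1
  rw [← pairEval_eq η v hab]
  simpa [hv, ha, hb] using q

/-- The isotropic vectors `e i ± g - (⟨g, g⟩ / 2) f i`. -/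
def twist (B : LinearMap.BilinForm K V) (e f g : V) (b : K) : V :=
  e + b • g - (B g g / 2 * b ^ 2) • f

theorem Hyperbolic.apply_twist_self (h : Hyperbolic B e f) (hs : B.IsSymm) (h2 : (2 : K) ≠ 0)
    {g : V} (hge : ∀ i, B g (e i) = 0) (hgf : ∀ i, B g (f i) = 0) (i : Fin p) (b : K) :
    B (twist B (e i) (f i) g b) (twist B (e i) (f i) g b) = 0 := by
  have l : ∀ i j, B (e i) (e j) = 0 := h.left
  have r : ∀ i j, B (f i) (f j) = 0 := h.right
  have d : ∀ i j, B (e i) (f j) = if i = j then 1 else 0 := h.dual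
  have d' := h.apply_flip hs
  have hs' : ∀ x y, B x y = B y x := hs.eq
  simp [twist, l, r, d, d', hge, hgf, hs' (e i) g, hs' (f i) g]
  field_simp
  ring

/-- The value on the twisted vector is a polynomial in `b` with a linear term from `g` and a
quadratic term from `f i`; the values `b = 1` and `b = -1` separate them. -/
theorem Hyperbolic.update_odd (h : Hyperbolic B e f) (hs : B.IsSymm) (h2 : (2 : K) ≠ 0) {g : V}
    (hg : B g g ≠ 0) (hge : ∀ i, B g (e i) = 0) (hgf : ∀ i, B g (f i) = 0)
    {k : ℕ} {η : V [⋀^Fin k]→ₗ[K] K} (h1 : ∀ i, VanishesAlong B η (e i))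
    (ht : ∀ i b, b ≠ 0 → VanishesAlong B η (twist B (e i) (f i) g b))
    {i : Fin p} {v : Fin k → V} {a : Fin k}
    (hi : ∀ c, c ≠ a → B (e i) (v c) = 0) (hi' : ∀ c, c ≠ a → B (f i) (v c) = 0)
    (hi'' : ∀ c, c ≠ a → B g (v c) = 0) :
    η (update v a g) = 0 ∧ η (update v a (f i)) = 0 := by
  have q1 := (h1 i).update_eq_zero (h.left i i) (v := v) (a := a) hi
  have q : ∀ b : K, b ≠ 0 →
      b * η (update v a g) - B g g / 2 * b ^ 2 * η (update v a (f i)) = 0 := by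
    intro b hb
    have := (ht i b hb).update_eq_zero (h.apply_twist_self hs h2 hge hgf i b) (v := v) (a := a)
      (fun c hc => by simp [twist, hi c hc, hi' c hc, hi'' c hc])
    simpa only [twist, η.map_update_sub, η.map_update_add, η.map_update_smul, q1, zero_add,
      smul_eq_mul] using this
  have q2 := q 1 one_ne_zero
  have q3 := q (-1) (neg_ne_zero.2 one_ne_zero)
  constructor
  · apply (mul_eq_zero_iff_left h2).1
    linear_combination q2 - q3
  · apply (mul_eq_zero_iff_left hg).1
    field_simp at q2 q3
    apply (mul_eq_zero_iff_left h2).1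
    linear_combination - q2 - q3

/-- The vector `g - (B g g * t) • f i` is orthogonal to the twisted vector with parameter `t`.
Pairing them gives terms linear and quadratic in `t`, separated by `t = 1` and `t = -1`. -/
theorem Hyperbolic.pairEval_odd (h : Hyperbolic B e f) (hs : B.IsSymm) (h2 : (2 : K) ≠ 0) {g : V}
    (hg : B g g ≠ 0) (hge : ∀ i, B g (e i) = 0) (hgf : ∀ i, B g (f i) = 0)
    {k : ℕ} {η : V [⋀^Fin k]→ₗ[K] K} (h1 : ∀ i, VanishesAlong B η (e i))
    (ht : ∀ i b, b ≠ 0 → VanishesAlong B η (twist B (e i) (f i) g b))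
    {i : Fin p} {v : Fin k → V} {a b : Fin k} (hab : a ≠ b)
    (hi : ∀ c, c ≠ a → c ≠ b → B (e i) (v c) = 0) (hi' : ∀ c, c ≠ a → c ≠ b → B (f i) (v c) = 0)
    (hi'' : ∀ c, c ≠ a → c ≠ b → B g (v c) = 0) :
    pairEval η v hab (e i) (f i) = 0 ∧ pairEval η v hab (f i) g = 0 := by
  have l : ∀ i j, B (e i) (e j) = 0 := h.left
  have r : ∀ i j, B (f i) (f j) = 0 := h.right
  have d : ∀ i j, B (e i) (f j) = if i = j then 1 else 0 := h.dual
  have d' := h.apply_flip hs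
  have hs' : ∀ x y, B x y = B y x := hs.eq
  have q1 := (h1 i).pairEval_eq_zero (l i i) hab hi (y := g) (by rw [hs', hge])
  have q2 := pairEval_swap η v hab g (f i)
  have q : ∀ t : K, t ≠ 0 → - B g g * t * pairEval η v hab (e i) (f i)
      + B g g / 2 * t ^ 2 * pairEval η v hab (f i) g = 0 := by
    intro t ht'
    have := (ht i t ht').pairEval_eq_zero (h.apply_twist_self hs h2 hge hgf i t) (v := v) hab
      (fun c hc hc' => by simp [twist, hi c hc hc', hi' c hc hc', hi'' c hc hc'])
      (y := g - (B g g * t) • f i)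
      (by simp [twist, r, d, hgf, hs' (e i) g, hs' (f i) g, hge]; ring)
    simp only [twist, map_add, map_sub, map_smul, LinearMap.add_apply, LinearMap.sub_apply,
      LinearMap.smul_apply, smul_eq_mul, pairEval_self, q1, q2] at this
    field_simp at this ⊢
    linear_combination this
  have q2 := q 1 one_ne_zero
  have q3 := q (-1) (neg_ne_zero.2 one_ne_zero)
  field_simp at q2 q3
  constructor
  · apply (mul_eq_zero_iff_left hg).1
    apply (mul_eq_zero_iff_left (mul_ne_zero h2 h2)).1
    linear_combination q3 - q2
  · apply (mul_eq_zero_iff_left hg).1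
    apply (mul_eq_zero_iff_left h2).1
    linear_combination q2 + q3

/-- The same case analysis with the extra basis vector `g`. If `g` occurs, counting provides an
index with no `e i`. The twisted vectors involve one index only, so no auxiliary second index is
needed. -/
theorem Hyperbolic.eq_zero_odd [FiniteDimensional K V] (h : Hyperbolic B e f) (hs : B.IsSymm)
    (h2 : (2 : K) ≠ 0) (hd : finrank K V = 2 * p + 1) (hp : 1 ≤ p) {g : V}
    (hg : B g g ≠ 0) (hge : ∀ i, B g (e i) = 0) (hgf : ∀ i, B g (f i) = 0)
    {η : V [⋀^Fin p]→ₗ[K] K} (h1 : ∀ i, VanishesAlong B η (e i))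
    (ht : ∀ i b, b ≠ 0 → VanishesAlong B η (twist B (e i) (f i) g b)) : η = 0 := by
  have l : ∀ i j, B (e i) (e j) = 0 := h.left
  have r : ∀ i j, B (f i) (f j) = 0 := h.right
  have d : ∀ i j, B (e i) (f j) = if i = j then 1 else 0 := h.dual
  have d' := h.apply_flip hs
  have hs' : ∀ x y, B x y = B y x := hs.eq
  have : Nonempty (Fin p) := ⟨⟨0, by omega⟩⟩
  let bs := basisOfLinearIndependentOfCardEqFinrank (h.linearIndependent_snoc hs hg hge hgf)
    (by simp [hd]; omega)
  have hbs : ⇑bs = Sum.elim (Sum.elim e f) (fun _ => g) :=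
    coe_basisOfLinearIndependentOfCardEqFinrank _ _
  refine bs.ext_alternating fun s hinj => ?_
  rw [hbs, AlternatingMap.zero_apply]
  set v : Fin p → V := fun c => Sum.elim (Sum.elim e f) (fun _ => g) (s c) with hv
  have oe : ∀ i c, s c ≠ Sum.inl (Sum.inr i) → B (e i) (v c) = 0 := by
    intro i c hc
    simp only [hv]
    rcases hsc : s c with (m | m) | m
    · simp [l]
    · rw [Sum.elim_inl, Sum.elim_inr, d, if_neg]
      rintro rfl; exact hc hsc
    · simp [hs' _ g, hge]
  have of : ∀ i c, s c ≠ Sum.inl (Sum.inl i) → B (f i) (v c) = 0 := by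
    intro i c hc
    simp only [hv]
    rcases hsc : s c with (m | m) | m
    · rw [Sum.elim_inl, Sum.elim_inl, d', if_neg]
      rintro rfl; exact hc hsc
    · simp [r]
    · simp [hs' _ g, hgf]
  have og : ∀ c, s c ≠ Sum.inr () → B g (v c) = 0 := by
    intro c hc
    simp only [hv]
    rcases hsc : s c with (m | m) | m
    · simp [hge]
    · simp [hgf]
    · exact absurd hsc hc
  by_cases hA : ∃ i, (∃ c, s c = Sum.inl (Sum.inl i)) ∧ ∀ c, s c ≠ Sum.inl (Sum.inr i)
  · obtain ⟨i, ⟨c, hc⟩, hi⟩ := hA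
    exact h1 i v c (by simp [hv, hc]) fun j => oe i j (hi j)
  push Not at hA
  by_cases hG : ∃ c, s c = Sum.inr ()
  · obtain ⟨b, hb⟩ := hG
    obtain ⟨i, hi⟩ : ∃ i, ∀ c, s c ≠ Sum.inl (Sum.inl i) := by
      by_contra hcon
      push Not at hcon
      have hsur : Surjective s := by
        rintro ((j | j) | j)
        · exact hcon j
        · exact hA j (hcon j)
        · exact ⟨b, hb⟩
      have := Fintype.card_le_of_surjective s hsur
      simp at this
    by_cases hi' : ∃ c, s c = Sum.inl (Sum.inr i)
    · obtain ⟨a, ha⟩ := hi'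
      have hab : a ≠ b := by rintro rfl; simp [ha] at hb
      have q := (h.pairEval_odd hs h2 hg hge hgf h1 ht (i := i) (v := v) hab
        (fun c hc _ => oe i c fun h => hc (hinj (h.trans ha.symm)))
        (fun c _ _ => of i c (hi c))
        (fun c _ hc => og c fun h => hc (hinj (h.trans hb.symm)))).2
      rw [← pairEval_eq η v hab]
      simpa [hv, ha, hb] using q
    · push Not at hi'
      have q := (h.update_odd hs h2 hg hge hgf h1 ht (i := i) (v := v) (a := b)
        (fun c _ => oe i c (hi' c)) (fun c _ => of i c (hi c))
        (fun c hc => og c fun h => hc (hinj (h.trans hb.symm)))).1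
      rwa [show g = v b by simp [hv, hb], update_eq_self] at q
  push Not at hG
  obtain ⟨i, b, hb⟩ : ∃ i c, s c = Sum.inl (Sum.inr i) := by
    rcases h0 : s (Classical.arbitrary _) with (i | i) | i
    · exact ⟨i, hA i ⟨_, h0⟩⟩
    · exact ⟨i, _, h0⟩
    · exact absurd h0 (hG _)
  by_cases hi : ∃ c, s c = Sum.inl (Sum.inl i)
  · obtain ⟨a, ha⟩ := hi
    have hab : a ≠ b := by rintro rfl; simp [ha] at hb
    have q := (h.pairEval_odd hs h2 hg hge hgf h1 ht (i := i) (v := v) hab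
        (fun c _ hc => oe i c fun h => hc (hinj (h.trans hb.symm)))
        (fun c hc _ => of i c fun h => hc (hinj (h.trans ha.symm)))
        (fun c _ _ => og c (hG c))).1
    rw [← pairEval_eq η v hab]
    simpa [hv, ha, hb] using q
  · push Not at hi
    have q := (h.update_odd hs h2 hg hge hgf h1 ht (i := i) (v := v) (a := b)
        (fun c hc => oe i c fun h => hc (hinj (h.trans hb.symm))) (fun c _ => of i c (hi c))
        (fun c _ => og c (hG c))).2
    rwa [show f i = v b by simp [hv, hb], update_eq_self] at q

end Hyperbolic

/-! ### Gluing the local pure forms -/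

section Core

variable {K V : Type*} [Field K] [AddCommGroup V] [Module K V] {B : LinearMap.BilinForm K V}

theorem Hyperbolic.exists_orthogonal [FiniteDimensional K V]
    {p : ℕ} {e f : Fin p → V} (h : Hyperbolic B e f)
    (hs : B.IsSymm) (hn : B.Nondegenerate) (hd : finrank K V = 2 * p + 1) :
    ∃ g, B g g ≠ 0 ∧ (∀ i, B g (e i) = 0) ∧ ∀ i, B g (f i) = 0 := by
  have hs' : ∀ x y, B x y = B y x := hs.eq
  set N := Submodule.span K (Set.range (Sum.elim e f)) with hN
  have hN1 : finrank K N = 2 * p := by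
    rw [hN, finrank_span_eq_card (h.linearIndependent hs)]
    simp; omega
  have hO : finrank K (B.orthogonal N) = 1 := by
    rw [LinearMap.BilinForm.finrank_orthogonal hn, hN1, hd]; omega
  have hmem : ∀ x, x ∈ B.orthogonal N ↔ (∀ i, B x (e i) = 0) ∧ ∀ i, B x (f i) = 0 := by
    intro x
    rw [LinearMap.BilinForm.mem_orthogonal_iff]
    constructor
    · intro hx
      refine ⟨fun i => ?_, fun i => ?_⟩
      · rw [hs']; exact hx _ (Submodule.subset_span ⟨Sum.inl i, rfl⟩)
      · rw [hs']; exact hx _ (Submodule.subset_span ⟨Sum.inr i, rfl⟩)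
    · rintro ⟨h1, h2⟩ n hn
      have : N ≤ LinearMap.ker (B x) := by
        rw [hN, Submodule.span_le]
        rintro _ ⟨i | i, rfl⟩
        · exact h1 i
        · exact h2 i
      rw [hs']
      exact this hn
  obtain ⟨⟨g, hg⟩, hg0, hgs⟩ := finrank_eq_one_iff'.1 hO
  obtain ⟨hge, hgf⟩ := (hmem g).1 hg
  refine ⟨g, fun hgg => hg0 ?_, hge, hgf⟩
  rw [Submodule.mk_eq_zero]
  refine hn.1 g fun x => ?_
  have l : ∀ i j, B (e i) (e j) = 0 := h.left
  have r : ∀ i j, B (f i) (f j) = 0 := h.right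
  have d : ∀ i j, B (e i) (f j) = if i = j then 1 else 0 := h.dual
  have d' := h.apply_flip hs
  -- Subtracting the hyperbolic part of `x` lands in the line of `g`; if `g` were isotropic, it
  -- would be orthogonal to every `x`, against nondegeneracy.
  have hx : x - ∑ i, B x (f i) • e i - ∑ i, B x (e i) • f i ∈ B.orthogonal N := by
    rw [hmem]
    constructor <;> intro i <;> simp [LinearMap.sum_apply, l, r, d, d']
  obtain ⟨c, hc⟩ := hgs ⟨_, hx⟩
  have hc' := congrArg (fun z : B.orthogonal N => B g (z : V)) hc
  simpa [hgg, hge, hgf, map_sum] using hc'.symm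

theorem IsoTuple.update {ι : Type*} [DecidableEq ι] {z : ι → V} (hz : IsoTuple B z) (hs : B.IsSymm)
    {e : V} {k : ι} (he : B e e = 0) (h : ∀ j, j ≠ k → B e (z j) = 0) :
    IsoTuple B (update z k e) := by
  have hs' : ∀ x y, B x y = B y x := hs.eq
  intro i j
  rcases eq_or_ne i k with rfl | hi <;> rcases eq_or_ne j i with rfl | hj
  · simpa using he
  · simpa [hj] using h j hj
  · simpa [hi] using hz j j
  · rcases eq_or_ne j k with rfl | hjk
    · simpa [hi] using (hs' _ _).trans (h i hi)
    · simpa [hi, hjk] using hz i j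

/-- A tuple through `e` with nonzero value gives a pure form along `e` with normalized factors `z`.
Replacing `z k` by `e` keeps isotropy, and an isotropic dual `w` of the new tuple has all entries
but the `k`-th orthogonal to `e`. Putting `e` back into slot `k` of `w` gives an isotropic tuple on
which the form of `z` is `1`. -/
theorem PureAlong.exists_isoTuple [FiniteDimensional K V]
    {p : ℕ} {ω : V [⋀^Fin p]→ₗ[K] K} {e : V} (hs : B.IsSymm)
    (hn : B.Nondegenerate) (h2 : (2 : K) ≠ 0) (h : PureAlong B ω e) (he : B e e = 0) (he0 : e ≠ 0)
    (hv : ¬ VanishesAlong B ω e) : ∃ t : Fin p → V, IsoTuple B t ∧ ω t = 1 := by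
  have hs' : ∀ x y, B x y = B y x := hs.eq
  obtain ⟨y, hy, hya⟩ := h
  simp only [VanishesAlong, AlternatingMap.sub_apply, sub_eq_zero] at hya
  unfold VanishesAlong at hv
  push Not at hv
  obtain ⟨v, k, hvk, hve, hv0⟩ := hv
  rw [hya v k hvk hve] at hv0
  obtain ⟨z, hz, hzd, hyz⟩ := exists_dualTuples_of_toForm_ne_zero hy hv0
  set m := toForm B p (exteriorPower.ιMulti K p y) v with hm
  have hzd' : ∀ i j, B (z i) (v j) = if i = j then 1 else 0 := hzd
  have hze : ∀ i, i ≠ k → B e (z i) = 0 := by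
    intro i hi
    rw [hs', ← hvk, hzd', if_neg hi]
  have hu : IsoTuple B (update z k e) := hz.update hs he hze
  have hli : LinearIndependent K (update z k e) := by
    rw [Fintype.linearIndependent_iff]
    intro c hc
    have hck : ∀ j, j ≠ k → c j = 0 := by
      intro j hj
      have := congrArg (fun x => B x (v j)) hc
      simp only [map_sum, LinearMap.sum_apply, map_smul, LinearMap.smul_apply, map_zero,
        LinearMap.zero_apply] at this
      rw [Finset.sum_eq_single j] at this
      · simpa [hj, hzd'] using this
      · intro i _ hij
        rcases eq_or_ne i k with rfl | hi
        · simp [hve]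
        · simp [hi, hzd', hij]
      · simp
    intro i
    rcases eq_or_ne i k with rfl | hi
    · rw [Finset.sum_eq_single i (fun j _ hj => by simp [hck j hj]) (by simp)] at hc
      simpa [he0] using hc
    · exact hck i hi
  obtain ⟨w, hw, hwd⟩ := exists_dualTuple hs hn h2 hu hli
  have hew : ∀ j, j ≠ k → B e (w j) = 0 := by
    intro j hj
    simpa [hj.symm] using hwd k j
  have ht : IsoTuple B (update w k e) := hw.update hs he hew
  have hzt : toForm B p (exteriorPower.ιMulti K p z) (update w k e) = 1 := by
    rw [toForm_ιMulti, ← Matrix.det_one (n := Fin p) (R := K)]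
    refine det_eq_of_column_single k (fun r => ?_) (fun r => ?_) (fun r hr j => ?_)
    · simpa [hvk] using hzd' r k
    · simp [Matrix.one_apply]
    · rcases eq_or_ne j k with rfl | hj
      · simpa [hvk, Matrix.one_apply] using hzd' r j
      · simpa [hj, hr, Matrix.one_apply] using hwd r j
  have hωt : ω (update w k e) = m := by
    rw [hya _ k (by simp) (fun j => by simpa using ht k j), hyz, AlternatingMap.smul_apply, hzt,
      smul_eq_mul, mul_one]
  refine ⟨update (update w k e) k (m⁻¹ • update w k e k), ?_, ?_⟩
  · rw [update_idem, update_self]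
    exact hw.update hs (by simp [he]) fun j hj => by simp [hew j hj]
  · rw [ω.map_update_smul, update_eq_self, hωt, smul_eq_mul, inv_mul_cancel₀ hv0]

/-- If `ω` is pure along all nonzero isotropic vectors and takes the value `1` on an isotropic tuple
`t`, then `t` has a dual isotropic tuple, which determines a form that agrees with `ω` along many
vectors. -/
theorem exists_hyperbolic_agree [FiniteDimensional K V]
    {p : ℕ} (hp : 3 ≤ p) {ω : V [⋀^Fin p]→ₗ[K] K} (hs : B.IsSymm)
    (hn : B.Nondegenerate) (hω : ∀ e, e ≠ 0 → B e e = 0 → PureAlong B ω e)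
    {t : Fin p → V} (ht : IsoTuple B t) (h1 : ω t = 1) :
    ∃ f, Hyperbolic B t f ∧
      (∀ i, VanishesAlong B (ω - toForm B p (exteriorPower.ιMulti K p f)) (t i)) ∧
      ∀ (s : Fin p → V) (I : Finset (Fin p)) (i : Fin p), i ∈ I → I.card + 3 ≤ p →
        (∀ j, j ∉ I → s j = t j) → (∀ a, a ∉ I → ∀ j, B (t a) (s j) = 0) →
        (∀ j, B (s i) (s j) = 0) → toForm B p (exteriorPower.ιMulti K p f) s = 1 →
        VanishesAlong B (ω - toForm B p (exteriorPower.ιMulti K p f)) (s i) := by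
  have hs' : ∀ x y, B x y = B y x := hs.eq
  have ht' : ∀ i j, B (t i) (t j) = 0 := ht
  have hcard : ∀ I : Finset (Fin p), I.card < p → ∃ a, a ∉ I := by
    intro I hI
    by_contra hcon
    push Not at hcon
    rw [Finset.eq_univ_iff_forall.2 hcon] at hI
    simp at hI
  have ht0 : ∀ i, t i ≠ 0 := fun i hi => by
    rw [ω.map_coord_zero i hi] at h1
    exact zero_ne_one h1
  let f : Fin p → V := fun i => (B.toDual hn).symm (ω.toMultilinearMap.toLinearMap t i)
  have hf : ∀ i v, B (f i) v = ω (update t i v) := fun i v =>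
    LinearMap.BilinForm.apply_toDual_symm_apply _ _
  have hft : DualTuples B f t := by
    intro i j
    rw [hf]
    split_ifs with hij
    · subst hij; rw [update_eq_self, h1]
    · exact ω.map_update_self t hij
  have hft' : ∀ i j, B (f i) (t j) = if i = j then 1 else 0 := hft
  have hfi : IsoTuple B f := by
    intro i j
    -- A third index `k` exists because `p ≥ 3`. Let `z` be the factors of the pure form along `t
    -- k`. On the orthogonal complement of `t k`, which contains `f j` and `z i`, the vectors `f i`
    -- and `f j` act as `z i` and `z j`; hence `B (f i) (f j) = B (z j) (z i) = 0`.
    obtain ⟨k, hk⟩ := hcard {i, j} (lt_of_le_of_lt Finset.card_le_two hp)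
    simp only [Finset.mem_insert, Finset.mem_singleton, not_or] at hk
    obtain ⟨z, hz, hzd, -, hzω⟩ :=
      (hω (t k) (ht0 k) (ht' k k)).exists_dualTuples (s := t) (i := k) rfl (ht' k) h1
    have hkz : ∀ i, i ≠ k → B (t k) (z i) = 0 := by
      intro i hi
      have := hzd i k
      rwa [if_neg hi, hs'] at this
    have hkf : B (t k) (f j) = 0 := by
      rw [hs', hft', if_neg (Ne.symm hk.2)]
    rw [hf, ← hzω i (Ne.symm hk.1) _ hkf, hs', hf,
      ← hzω j (Ne.symm hk.2) _ (hkz i (Ne.symm hk.1))]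
    exact hz j i
  have hF : ∀ e, PureAlong B (toForm B p (exteriorPower.ιMulti K p f)) e := fun e =>
    ⟨f, hfi, fun v _ _ _ => by simp⟩
  have hFt : toForm B p (exteriorPower.ιMulti K p f) t = 1 := by
    have i : Fin p := ⟨0, by omega⟩
    have := hft.toForm_update i (t i)
    rw [update_eq_self] at this
    rw [this, hft', if_pos rfl]
  have hη : ∀ i, VanishesAlong B (ω - toForm B p (exteriorPower.ιMulti K p f)) (t i) := fun i =>
    (hω _ (ht0 i) (ht' i i)).vanishesAlong_sub (hF _) (s := t) (i := i) rfl (ht' i) hFt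
      (by rw [AlternatingMap.sub_apply, h1, hFt, sub_self])
      (fun j _ v _ => by rw [AlternatingMap.sub_apply, hft.toForm_update, hf, sub_self])
  refine ⟨f, ⟨ht, hfi, fun i j => ?_⟩, hη, ?_⟩
  · rw [hs', hft']
    simp only [eq_comm]
  · intro s I i hiI hI hsI hIs hsi hFs
    have hsi0 : s i ≠ 0 := fun hi => by
      rw [AlternatingMap.map_coord_zero _ i hi] at hFs
      exact zero_ne_one hFs
    refine (hω _ hsi0 (hsi i)).vanishesAlong_sub (hF _) (s := s) (i := i) rfl hsi hFs ?_ ?_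
    · obtain ⟨a, ha⟩ := hcard I (by omega)
      exact hη a s a (hsI a ha) (hIs a ha)
    · intro j hj v hv
      -- Two untouched entries `t a`, `t b` survive after freeing slot `j`: this is where `I.card +
      -- 3 ≤ p` is spent. The vector `f a` pairs to `1` with `t a` and to `0` with `t b`, as
      -- `VanishesAlong.eq_zero_of_two` requires.
      obtain ⟨a, ha⟩ := hcard (insert j I) (by have := Finset.card_insert_le j I; omega)
      obtain ⟨b, hb⟩ := hcard (insert a (insert j I)) (by
        have := Finset.card_insert_le j I
        have := Finset.card_insert_le a (insert j I)
        omega)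
      simp only [Finset.mem_insert, not_or] at ha hb
      refine (hη a).eq_zero_of_two (hη b) (f := f a) (i := j) (a := a) (b := b) ?_ ?_ ?_ ?_
        ha.1 hb.2.1 ?_ ?_
      · rw [hs', hft', if_pos rfl]
      · rw [hs', hft', if_neg (Ne.symm hb.1)]
      · rw [update_of_ne ha.1, hsI a ha.2]
      · rw [update_of_ne hb.2.1, hsI b hb.2.2]
      · intro l hl
        rw [update_of_ne hl]; exact hIs a ha.2 l
      · intro l hl
        rw [update_of_ne hl]; exact hIs b hb.2.2 l

theorem exists_ιMulti_of_eq_zero {p : ℕ} (hp : 1 ≤ p) :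
    ∃ f : Fin p → V, IsoTuple B f ∧ (0 : V [⋀^Fin p]→ₗ[K] K) =
      toForm B p (exteriorPower.ιMulti K p f) := by
  have : Nonempty (Fin p) := ⟨⟨0, by omega⟩⟩
  exact ⟨0, fun i j => by simp, by rw [AlternatingMap.map_zero, map_zero]⟩

/-- Twisting `e i` by `g` and `f i` leaves it orthogonal to the other `e a`, so only one entry of
the tuple changes and `p ≥ 4` is enough. -/
theorem exists_ιMulti_of_pureAlong_odd [FiniteDimensional K V]
    {p : ℕ} (hp : 4 ≤ p) (hs : B.IsSymm)
    (hn : B.Nondegenerate) (h2 : (2 : K) ≠ 0) (hd : finrank K V = 2 * p + 1)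
    (hB : ∃ e f : Fin p → V, Hyperbolic B e f) {ω : V [⋀^Fin p]→ₗ[K] K}
    (hω : ∀ e, e ≠ 0 → B e e = 0 → PureAlong B ω e) :
    ∃ f : Fin p → V, IsoTuple B f ∧ ω = toForm B p (exteriorPower.ιMulti K p f) := by
  have hs' : ∀ x y, B x y = B y x := hs.eq
  by_cases h0 : ∀ e, e ≠ 0 → B e e = 0 → VanishesAlong B ω e
  · obtain ⟨e, f, h⟩ := hB
    obtain ⟨g, hg, hge, hgf⟩ := h.exists_orthogonal hs hn hd
    have d : ∀ i j, B (e i) (f j) = if i = j then 1 else 0 := h.dual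
    have r : ∀ i j, B (f i) (f j) = 0 := h.right
    have : ω = 0 := h.eq_zero_odd hs h2 hd (by omega) hg hge hgf
      (fun i => h0 _ (fun hi => by simpa [hi] using d i i) (h.left i i))
      (fun i b _ => h0 _ (fun hi => by
        have : B (twist B (e i) (f i) g b) (f i) = 1 := by simp [twist, d, r, hgf]
        simp [hi] at this) (h.apply_twist_self hs h2 hge hgf i b))
    rw [this]
    exact exists_ιMulti_of_eq_zero (by omega)
  push Not at h0
  obtain ⟨e₀, he0, hee, hv⟩ := h0
  obtain ⟨e, he, h1⟩ := (hω e₀ he0 hee).exists_isoTuple hs hn h2 hee he0 hv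
  obtain ⟨f, h, hη, hstep⟩ := exists_hyperbolic_agree (by omega) hs hn hω he h1
  obtain ⟨g, hg, hge, hgf⟩ := h.exists_orthogonal hs hn hd
  refine ⟨f, h.right, sub_eq_zero.1 (h.eq_zero_odd hs h2 hd (by omega) hg hge hgf hη ?_)⟩
  have l : ∀ i j, B (e i) (e j) = 0 := h.left
  have r : ∀ i j, B (f i) (f j) = 0 := h.right
  have d : ∀ i j, B (e i) (f j) = if i = j then 1 else 0 := h.dual
  have d' := h.apply_flip hs
  intro i b _
  have hij : ∀ a, a ≠ i → B (e a) (twist B (e i) (f i) g b) = 0 := fun a ha => by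
    simp [twist, l, d, ha, hs' (e a) g, hge]
  have key := hstep (update e i (twist B (e i) (f i) g b)) {i} i (by simp) (by simpa using hp)
    (fun j hj => by simp at hj; simp [hj])
    (fun a ha j => by
      simp only [Finset.mem_singleton] at ha
      exact orthogonal_update (l a) (hij a ha) i j)
    (fun j => by
      rcases eq_or_ne j i with rfl | hj
      · simpa using h.apply_twist_self hs h2 hge hgf j b
      · simpa [hj] using (hs' _ _).trans (hij j hj))
    (by
      have hfe : DualTuples B f e := d'
      rw [hfe.toForm_update]
      simp [twist, d', r, hs' (f i) g, hgf])
  simpa using key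

/-- The vector `e i + c • f j` is not orthogonal to `e j` when `c ≠ 0`, so a second entry must be
altered; this forces `p ≥ 5`. -/
theorem exists_ιMulti_of_pureAlong_even [FiniteDimensional K V]
    {p : ℕ} (hp : 5 ≤ p) (hs : B.IsSymm)
    (hn : B.Nondegenerate) (h2 : (2 : K) ≠ 0) (hd : finrank K V = 2 * p)
    (hB : ∃ e f : Fin p → V, Hyperbolic B e f) {ω : V [⋀^Fin p]→ₗ[K] K}
    (hω : ∀ e, e ≠ 0 → B e e = 0 → PureAlong B ω e) :
    ∃ f : Fin p → V, IsoTuple B f ∧ ω = toForm B p (exteriorPower.ιMulti K p f) := by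
  have hs' : ∀ x y, B x y = B y x := hs.eq
  by_cases h0 : ∀ e, e ≠ 0 → B e e = 0 → VanishesAlong B ω e
  · obtain ⟨e, f, h⟩ := hB
    have l : ∀ i j, B (e i) (e j) = 0 := h.left
    have r : ∀ i j, B (f i) (f j) = 0 := h.right
    have d : ∀ i j, B (e i) (f j) = if i = j then 1 else 0 := h.dual
    have d' := h.apply_flip hs
    have h0' : ∀ x i, B x (f i) = 1 → B x x = 0 → VanishesAlong B ω x := fun x i hx =>
      h0 x (fun hx0 => by simp [hx0] at hx)
    have : ω = 0 := h.eq_zero_even hs h2 hd (by omega)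
      (fun i => h0' _ i (by simp [d]) (l i i))
      (fun i j hij => h0' _ i (by simp [d, hij.symm]) (by simp [l]))
      (fun i j hij => h0' _ i (by simp [d, r]) (by simp [l, r, d, d', hij, hij.symm]))
      (fun i j hij => h0' _ i (by simp [d, r]) (by simp [l, r, d, d', hij, hij.symm]))
    rw [this]
    exact exists_ιMulti_of_eq_zero (by omega)
  push Not at h0
  obtain ⟨e₀, he0, hee, hv⟩ := h0
  obtain ⟨e, he, h1⟩ := (hω e₀ he0 hee).exists_isoTuple hs hn h2 hee he0 hv
  obtain ⟨f, h, hη, hstep⟩ := exists_hyperbolic_agree (by omega) hs hn hω he h1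
  have l : ∀ i j, B (e i) (e j) = 0 := h.left
  have r : ∀ i j, B (f i) (f j) = 0 := h.right
  have d : ∀ i j, B (e i) (f j) = if i = j then 1 else 0 := h.dual
  have d' := h.apply_flip hs
  have hfe : DualTuples B f e := d'
  have hef : ∀ c : K, ∀ i j, i ≠ j → VanishesAlong B
      (ω - toForm B p (exteriorPower.ιMulti K p f)) (e i + c • f j) := by
    intro c i j hij
    -- The compensating entry `e j - c • f i` restores isotropy. The changes lie in the span of the
    -- `f`, which is isotropic, so the value of the form of `f` stays `1`.
    have hs1 : ∀ a, update (update e i (e i + c • f j)) j (e j - c • f i) a =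
        e a + (if a = i then c • f j else 0) - (if a = j then c • f i else 0) := by
      intro a
      rcases eq_or_ne a j with rfl | haj
      · simp [hij.symm]
      · rcases eq_or_ne a i with rfl | hai
        · simp [haj]
        · simp [haj, hai]
    have key := hstep (update (update e i (e i + c • f j)) j (e j - c • f i)) {i, j} i (by simp)
      (by rw [Finset.card_pair hij]; exact hp)
      (fun a ha => by
        simp only [Finset.mem_insert, Finset.mem_singleton, not_or] at ha
        simp [ha.1, ha.2])
      (fun a ha b => by
        simp only [Finset.mem_insert, Finset.mem_singleton, not_or] at ha
        rw [hs1]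
        split_ifs <;> simp [l, d, ha.1, ha.2])
      (fun a => by
        rw [hs1, hs1]
        rcases eq_or_ne a i with rfl | hai
        · simp [hij, hij.symm, l, r, d, d']
        · rcases eq_or_ne a j with rfl | haj
          · simp [hij, hij.symm, l, r, d, d']
          · simp [hij, hai, haj, l, d', Ne.symm haj])
      (by
        rw [toForm_ιMulti, ← Matrix.det_one (n := Fin p) (R := K)]
        congr 1
        ext a b
        rw [Matrix.of_apply, hs1, Matrix.one_apply, ← d']
        split_ifs <;> simp [r])
    rw [hs1] at key
    simpa [hij] using key
  refine ⟨f, h.right, sub_eq_zero.1 (h.eq_zero_even hs h2 hd (by omega) hη ?_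
    (fun i j hij => by simpa using hef 1 i j hij)
    (fun i j hij => by simpa [sub_eq_add_neg] using hef (-1) i j hij))⟩
  intro i j hij
  have key := hstep (update e i (e i + e j)) {i} i (by simp) (by simp; omega)
    (fun j hj => by simp at hj; simp [hj])
    (fun a _ b => orthogonal_update (l a) (by simp [l]) i b)
    (fun a => by
      rw [update_self]
      exact orthogonal_update (fun b => by simp [l]) (by simp [l]) i a)
    (by rw [hfe.toForm_update]; simp [d', hij])
  simpa using key

end Core

/-! ### The complement of a hyperbolic pair, and contraction of pure multivectors -/

section Reduction

variable {K V : Type*} [Field K] [AddCommGroup V] [Module K V]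

/-- A hyperbolic pair of vectors. -/
structure HypPair (B : LinearMap.BilinForm K V) (e f : V) : Prop where
  left : B e e = 0
  right : B f f = 0
  dual : B e f = 1

/-- The orthogonal complement of two vectors. -/
def perp (B : LinearMap.BilinForm K V) (e f : V) : Submodule K V :=
  LinearMap.ker (B e) ⊓ LinearMap.ker (B f)

variable {B : LinearMap.BilinForm K V} {e f : V}

theorem mem_perp {x : V} : x ∈ perp B e f ↔ B e x = 0 ∧ B f x = 0 := Iff.rfl

/-- The orthogonal projection to the complement of a hyperbolic pair. -/
def HypPair.proj (h : HypPair B e f) (hs : B.IsSymm) : V →ₗ[K] perp B e f :=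
  LinearMap.codRestrict _
    (LinearMap.id - (B f).smulRight e - (B e).smulRight f) fun x => by
      have hfe : B f e = 1 := (hs.eq _ _).trans h.dual
      rw [mem_perp]
      constructor <;> simp [h.left, h.right, h.dual, hfe]

theorem HypPair.coe_proj (h : HypPair B e f) (hs : B.IsSymm) (x : V) :
    (h.proj hs x : V) = x - B f x • e - B e x • f := rfl

theorem HypPair.apply_proj (h : HypPair B e f) (hs : B.IsSymm) (x : V) (y : perp B e f) :
    B (h.proj hs x) y = B x y := by
  have h1 := (mem_perp.1 y.2).1
  have h2 := (mem_perp.1 y.2).2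
  simp [h.coe_proj, h1, h2]

theorem restrict_isSymm (hs : B.IsSymm) (N : Submodule K V) : (B.restrict N).IsSymm :=
  ⟨fun x y => hs.eq x y⟩

theorem HypPair.restrict_nondegenerate (h : HypPair B e f) (hs : B.IsSymm) (hn : B.Nondegenerate) :
    (B.restrict (perp B e f)).Nondegenerate := by
  have hs' : ∀ x y, B x y = B y x := hs.eq
  have key : ∀ x : perp B e f, (∀ y : perp B e f, B x y = 0) → x = 0 := by
    intro x hx
    rw [← Submodule.coe_eq_zero]
    refine hn.1 _ fun y => ?_
    rw [hs', ← h.apply_proj hs, hs']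
    exact hx _
  exact ⟨fun x hx => key x hx, fun x hx => key x fun y => (hs' _ _).trans (hx y)⟩

theorem HypPair.finrank_perp [FiniteDimensional K V] (h : HypPair B e f) (hs : B.IsSymm) :
    finrank K (perp B e f) + 2 = finrank K V := by
  have hfe : B f e = 1 := (hs.eq _ _).trans h.dual
  have hsur : Surjective ((B e).prod (B f)) := by
    rintro ⟨a, b⟩
    refine ⟨b • e + a • f, ?_⟩
    simp [h.left, h.right, h.dual, hfe]
  have h1 := LinearMap.finrank_range_add_finrank_ker ((B e).prod (B f))
  rw [LinearMap.range_eq_top.2 hsur, finrank_top, LinearMap.ker_prod] at h1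
  simp only [finrank_prod, finrank_self] at h1
  unfold perp
  omega

/-- An isotropic vector of a nondegenerate space belongs to a hyperbolic pair. -/
theorem exists_hypPair [FiniteDimensional K V] (hs : B.IsSymm) (hn : B.Nondegenerate)
    (h2 : (2 : K) ≠ 0) (he : B e e = 0) (he0 : e ≠ 0) : ∃ f, HypPair B e f := by
  obtain ⟨w, hw, hd⟩ := exists_dualTuple hs hn h2 (ι := Unit) (u := fun _ => e) (fun _ _ => he)
    (LinearIndependent.of_subsingleton () he0)
  exact ⟨w (), he, hw () (), by simpa using hd () ()⟩

/-- A totally isotropic tuple can be contracted with a vector. -/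
theorem IsoTuple.exists_contract {n : ℕ} (hn : 1 ≤ n) {u : Fin (n + 1) → V} (hu : IsoTuple B u)
    (hs : B.IsSymm) (e : V) : ∃ w : Fin n → V, IsoTuple B w ∧ (∀ i, B e (w i) = 0) ∧
      ∀ v : Fin n → V, toForm B (n + 1) (exteriorPower.ιMulti K (n + 1) u) (Matrix.vecCons e v) =
        (Matrix.of fun i j => B (w i) (v j)).det := by
  have hs' : ∀ x y, B x y = B y x := hs.eq
  have hu' : ∀ i j, B (u i) (u j) = 0 := hu
  have : NeZero n := ⟨by omega⟩
  by_cases h0 : ∀ i, B (u i) e = 0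
  · refine ⟨0, fun i j => by simp, fun i => by simp, fun v => ?_⟩
    rw [toForm_ιMulti, Matrix.det_eq_zero_of_column_eq_zero 0 (fun i => by simp [h0]),
      Matrix.det_eq_zero_of_row_eq_zero 0 (fun i => by simp)]
  · push Not at h0
    obtain ⟨k, hk⟩ := h0
    set a := B (u k) e with ha
    -- Row operations make every factor but the `k`-th orthogonal to `e`, so only one term of the
    -- column expansion remains.
    let c : Fin (n + 1) → K := fun i => if i = k then 0 else B (u i) e / a
    let z : Fin (n + 1) → V := fun i => u i - c i • u k
    have hz : ∀ i j, B (z i) (z j) = 0 := fun i j => by simp [z, hu']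
    have hze : ∀ i, i ≠ k → B (z i) e = 0 := fun i hi => by
      simp only [z, c, if_neg hi, map_sub, map_smul, LinearMap.sub_apply, LinearMap.smul_apply,
        smul_eq_mul, ← ha]
      field_simp
      ring
    -- The sign and the pivot `a` from the expansion are absorbed into the first remaining factor,
    -- which exists because `n ≥ 1`.
    let s : Fin n → K := fun i => if i = 0 then (-1) ^ (k : ℕ) * a else 1
    refine ⟨fun i => s i • z (k.succAbove i), fun i j => by simp [hz], fun i => ?_, fun v => ?_⟩
    · rw [hs']
      simp [hze _ (Fin.succAbove_ne k i)]
    · rw [toForm_ιMulti, Matrix.det_eq_of_forall_row_eq_smul_add_const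
        (B := Matrix.of fun i j => B (z i) (Matrix.vecCons e v j)) c k (by simp [c])
        (fun i j => by by_cases hi : i = k <;> simp [z, c, hi]),
        Matrix.det_succ_column _ 0, Finset.sum_eq_single k]
      · have h1 : (Matrix.of fun i j => B (s i • z (k.succAbove i)) (v j)) =
            Matrix.of fun i j => s i *
              (Matrix.of fun i j => B (z (k.succAbove i)) (v j)) i j := by
          ext i j; simp
        rw [h1, Matrix.det_mul_column]
        congr 1
        simp [s, z, c, ha]
      · intro i _ hi
        simp [hze i hi]
      · simp

end Reduction

/-! ### Contraction and wedge maps -/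

section Maps

variable {K V : Type*} [Field K] [AddCommGroup V] [Module K V] [FiniteDimensional K V]
  {B : LinearMap.BilinForm K V} {e f : V}

/-- Contraction with `e`, followed by projection to the orthogonal complement of `e` and `f`, and
multiplication with `f` in the other direction. -/
theorem HypPair.exists_contract_wedge (h : HypPair B e f) (hs : B.IsSymm) (hn : B.Nondegenerate)
    (n : ℕ) : ∃ (Θ : ⋀[K]^(n + 1) V →ₗ[K] ⋀[K]^n (perp B e f))
      (Ψ : ⋀[K]^n (perp B e f) →ₗ[K] ⋀[K]^(n + 1) V),
      (1 ≤ n → IsIGCP B (B.restrict (perp B e f)) Θ) ∧ IsIGCP (B.restrict (perp B e f)) B Ψ ∧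
      Θ ∘ₗ Ψ = LinearMap.id ∧
      ∀ ω, PureAlong B (toForm B (n + 1) (Ψ (Θ ω))) e → PureAlong B (toForm B (n + 1) ω) e := by
  have hs' : ∀ x y, B x y = B y x := hs.eq
  have hfe : B f e = 1 := (hs' _ _).trans h.dual
  have hsN := restrict_isSymm hs (perp B e f)
  have hnN := h.restrict_nondegenerate hs hn
  let D := LinearEquiv.ofBijective _ (toForm_bijective hsN hnN n)
  let R : (V [⋀^Fin n]→ₗ[K] K) →ₗ[K] (perp B e f [⋀^Fin n]→ₗ[K] K) :=
    { toFun := fun η => η.compLinearMap (perp B e f).subtype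
      map_add' := fun _ _ => rfl
      map_smul' := fun _ _ => rfl }
  let C : (V [⋀^Fin (n + 1)]→ₗ[K] K) →ₗ[K] (V [⋀^Fin n]→ₗ[K] K) :=
    { toFun := fun η => η.curryLeft e
      map_add' := fun _ _ => rfl
      map_smul' := fun _ _ => rfl }
  let Θ : ⋀[K]^(n + 1) V →ₗ[K] ⋀[K]^n (perp B e f) :=
    D.symm.toLinearMap ∘ₗ R ∘ₗ C ∘ₗ toForm B (n + 1)
  have hΘ : ∀ ω v, toForm (B.restrict (perp B e f)) n (Θ ω) v =
      toForm B (n + 1) ω (Matrix.vecCons e fun i => (v i : V)) := by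
    intro ω v
    have : D (Θ ω) = R (C (toForm B (n + 1) ω)) := by simp [Θ]
    exact AlternatingMap.congr_fun this v
  let Ψ : ⋀[K]^n (perp B e f) →ₗ[K] ⋀[K]^(n + 1) V := exteriorPower.alternatingMapLinearEquiv
    (((exteriorPower.ιMulti K (n + 1)).curryLeft f).compLinearMap (perp B e f).subtype)
  have hΨ : ∀ u, Ψ (exteriorPower.ιMulti K n u) =
      exteriorPower.ιMulti K (n + 1) (Matrix.vecCons f fun i => (u i : V)) := fun u =>
    exteriorPower.alternatingMapLinearEquiv_apply_ιMulti _ _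
  have hΘΨ : Θ ∘ₗ Ψ = LinearMap.id := by
    apply exteriorPower.linearMap_ext
    ext1 u
    simp only [LinearMap.compAlternatingMap_apply, LinearMap.comp_apply, LinearMap.id_apply]
    apply toForm_injective hsN hnN
    ext v
    rw [hΘ, hΨ, toForm_ιMulti, toForm_ιMulti, Matrix.det_succ_column_zero, Fin.sum_univ_succ,
      Finset.sum_eq_zero]
    · simp [hfe]
      rfl
    · intro i _
      have := (mem_perp.1 (u i).2).1
      simp [hs' _ e, this]
  refine ⟨Θ, Ψ, ?_, ?_, hΘΨ, ?_⟩
  · rintro hn1 _ ⟨u, hu, rfl⟩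
    obtain ⟨w, hw, hwe, hwu⟩ := IsoTuple.exists_contract hn1 hu hs e
    have hw' : ∀ i j, B (w i) (w j) = 0 := hw
    refine ⟨fun i => h.proj hs (w i), fun i j => ?_, ?_⟩
    · change B (h.proj hs (w i)) (h.proj hs (w j)) = 0
      rw [h.apply_proj, h.coe_proj]
      simp [hw', hwe, hs' _ e]
    · apply toForm_injective hsN hnN
      ext v
      rw [hΘ, hwu, toForm_ιMulti]
      congr 1
      ext i j
      exact h.apply_proj hs _ _
  · rintro _ ⟨u, hu, rfl⟩
    refine ⟨Matrix.vecCons f fun i => (u i : V), ?_, (hΨ u).symm⟩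
    intro i j
    have hfu : ∀ i, B f (u i) = 0 := fun i => (mem_perp.1 (u i).2).2
    refine Fin.cases ?_ (fun i => ?_) i <;> refine Fin.cases ?_ (fun j => ?_) j
    · simp [h.right]
    · simp [hfu]
    · simp [hs' _ f, hfu]
    · simpa using hu i j
  · rintro ω ⟨y, hy, hv⟩
    refine ⟨y, hy, fun v i hi hve => ?_⟩
    -- Since `Θ` kills `ω - Ψ (Θ ω)`, its form vanishes on `e` followed by vectors of `perp B e f`.
    -- A vector orthogonal to `e` differs from such a vector by a multiple of `e`, which alternation
    -- removes.
    have key : VanishesAlong B (toForm B (n + 1) (ω - Ψ (Θ ω))) e := by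
      set η := toForm B (n + 1) (ω - Ψ (Θ ω)) with hη
      have hη0 : ∀ v : Fin n → perp B e f, η (Matrix.vecCons e fun i => (v i : V)) = 0 := by
        intro v
        have : Θ (ω - Ψ (Θ ω)) = 0 := by
          have := LinearMap.congr_fun hΘΨ (Θ ω)
          simp only [LinearMap.comp_apply, LinearMap.id_apply] at this
          rw [map_sub, this, sub_self]
        rw [hη, ← hΘ, this]
        simp
      refine vanishesAlong_of_slot 0 fun v hv0 hve => ?_
      have hvd : v = Matrix.vecCons e ((fun i => B f (v (Fin.succ i)) • e) +
          fun i => (h.proj hs (v (Fin.succ i)) : V)) := by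
        ext i
        refine Fin.cases ?_ (fun i => ?_) i
        · simp [hv0]
        · simp [h.coe_proj, hve]
      rw [hvd, ← AlternatingMap.curryLeft_apply_apply, AlternatingMap.map_add_univ,
        Finset.sum_eq_single ∅]
      · simp [hη0]
      · intro S _ hS
        obtain ⟨j, hj⟩ := Finset.nonempty_iff_ne_empty.2 hS
        set x := S.piecewise (fun i => B f (v (Fin.succ i)) • e)
          fun i => (h.proj hs (v (Fin.succ i)) : V) with hx
        have hxj : x j = B f (v (Fin.succ j)) • e := by simp [hx, hj]
        rw [← update_eq_self j x, hxj, AlternatingMap.map_update_smul,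
          AlternatingMap.curryLeft_apply_apply,
          AlternatingMap.map_eq_zero_of_eq _ _ (i := 0) (j := Fin.succ j) (by simp)
            (Fin.succ_ne_zero j).symm, smul_zero]
      · simp
    have h1 := key v i hi hve
    have h2 := hv v i hi hve
    rw [map_sub, AlternatingMap.sub_apply] at h1
    rw [AlternatingMap.sub_apply] at h2 ⊢
    linear_combination h1 + h2

end Maps

/-! ### Hyperbolic bases from the Witt index -/

section Witt

variable {K V : Type*} [Field K] [AddCommGroup V] [Module K V] {B : LinearMap.BilinForm K V}

/-- There are totally isotropic tuples of length `p` that are dual to each other. -/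
def HasHyperbolic (B : LinearMap.BilinForm K V) (p : ℕ) : Prop :=
  ∃ e f : Fin p → V, Hyperbolic B e f

theorem IsIsotropic.hasHyperbolic [FiniteDimensional K V]
    {L : Submodule K V} (hL : IsIsotropic B L) (hs : B.IsSymm)
    (hn : B.Nondegenerate) (h2 : (2 : K) ≠ 0) {p : ℕ} (hp : p ≤ finrank K L) :
    HasHyperbolic B p := by
  let b := finBasis K L
  have hli : LinearIndependent K (fun i : Fin p => (b (Fin.castLE hp i) : V)) :=
    (b.linearIndependent.map' L.subtype (Submodule.ker_subtype L)).comp _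
      (Fin.castLE_injective hp)
  have hi : IsoTuple B (fun i : Fin p => (b (Fin.castLE hp i) : V)) := fun i j =>
    hL _ (Submodule.coe_mem _) _ (Submodule.coe_mem _)
  obtain ⟨w, hw, hd⟩ := exists_dualTuple hs hn h2 hi hli
  exact ⟨_, w, hi, hw, hd⟩

/-- For an isotropic `L` of dimension `n + 1`, the part of `L` orthogonal to `e` projects to an
isotropic subspace of the complement. Exactly one dimension may be lost: through the kernel of the
projection if `e ∈ L`, through the intersection otherwise. -/
theorem HypPair.hasHyperbolic_restrict [FiniteDimensional K V]
    {e f : V} (h : HypPair B e f) (hs : B.IsSymm)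
    (hn : B.Nondegenerate) (h2 : (2 : K) ≠ 0) {n : ℕ} (hB : HasHyperbolic B (n + 1)) :
    HasHyperbolic (B.restrict (perp B e f)) n := by
  have hs' : ∀ x y, B x y = B y x := hs.eq
  have he0 : e ≠ 0 := fun he => by simpa [he] using h.dual
  obtain ⟨x, y, hxy⟩ := hB
  set L := Submodule.span K (Set.range x) with hL
  have hLd : finrank K L = n + 1 := by
    rw [hL, finrank_span_eq_card hxy.dual.linearIndependent, Fintype.card_fin]
  have hLi : IsIsotropic B L := by
    have h1 : ∀ i, L ≤ LinearMap.ker (B (x i)) := fun i => by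
      rw [hL, Submodule.span_le]
      rintro _ ⟨j, rfl⟩
      exact hxy.left i j
    intro u hu v hv
    have h2 : L ≤ LinearMap.ker (B v) := by
      rw [hL, Submodule.span_le]
      rintro _ ⟨j, rfl⟩
      exact (hs' _ _).trans (h1 j hv)
    exact (hs' _ _).trans (h2 hu)
  have hker : ∀ v ∈ L ⊓ LinearMap.ker (B e), h.proj hs v = 0 → v = B f v • e := by
    intro v hv hv0
    have h3 := congrArg Subtype.val hv0
    have h4 : B e v = 0 := hv.2
    rw [h.coe_proj, h4] at h3
    simpa [sub_eq_zero] using h3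
  set L' := (L ⊓ LinearMap.ker (B e)).map (h.proj hs) with hL'
  refine IsIsotropic.hasHyperbolic (L := L') ?_ (restrict_isSymm hs _)
    (h.restrict_nondegenerate hs hn) h2 ?_
  · rintro _ ⟨u, hu, rfl⟩ _ ⟨v, hv, rfl⟩
    change B (h.proj hs u) (h.proj hs v) = 0
    have h3 : B e u = 0 := hu.2
    have h4 : B e v = 0 := hv.2
    rw [h.apply_proj, h.coe_proj]
    simp [hLi u hu.1 v hv.1, h4, hs' u e, h3]
  · set φ := (h.proj hs).domRestrict (L ⊓ LinearMap.ker (B e)) with hφ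
    have hr : finrank K (LinearMap.range φ) = finrank K L' := by
      rw [hφ, LinearMap.range_domRestrict]
    have hrk := LinearMap.finrank_range_add_finrank_ker φ
    by_cases heL : e ∈ L
    · have h5 : L ⊓ LinearMap.ker (B e) = L := inf_eq_left.2 fun v hv => hLi e heL v hv
      have h6 : finrank K (LinearMap.ker φ) ≤ 1 := by
        have h7 : (LinearMap.ker φ).map (Submodule.subtype _) ≤ Submodule.span K {e} := by
          rintro _ ⟨v, hv, rfl⟩
          rw [Submodule.mem_span_singleton]
          exact ⟨_, (hker v v.2 hv).symm⟩
        have h8 := Submodule.finrank_mono h7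
        rw [Submodule.finrank_map_subtype_eq] at h8
        exact h8.trans (finrank_span_singleton he0).le
      have h9 : finrank K ↥(L ⊓ LinearMap.ker (B e)) = n + 1 := by rw [h5, hLd]
      omega
    · have h6 : LinearMap.ker φ = ⊥ := by
        rw [LinearMap.ker_eq_bot']
        intro v hv
        have h7 := hker v v.2 hv
        by_cases hc : B f v = 0
        · rw [hc, zero_smul] at h7
          exact Subtype.ext h7
        · refine absurd ?_ heL
          have h8 : e = (B f v)⁻¹ • (v : V) := (eq_inv_smul_iff₀ hc).2 h7.symm
          rw [h8]
          exact L.smul_mem _ v.2.1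
      rw [h6, finrank_bot] at hrk
      have h9 := LinearMap.finrank_range_add_finrank_ker ((B e).domRestrict L)
      have h10 : finrank K (LinearMap.range ((B e).domRestrict L)) ≤ 1 :=
        (Submodule.finrank_le _).trans (finrank_self K).le
      have h11 : finrank K (LinearMap.ker ((B e).domRestrict L)) =
          finrank K ↥(L ⊓ LinearMap.ker (B e)) := by
        rw [← Submodule.finrank_map_subtype_eq L, LinearMap.ker_domRestrict,
          Submodule.map_comap_subtype]
      omega

theorem HypPair.hyperbolic_cons {e f : V} (h : HypPair B e f) (hs : B.IsSymm) {n : ℕ}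
    (hB : HasHyperbolic (B.restrict (perp B e f)) n) : HasHyperbolic B (n + 1) := by
  have hs' : ∀ x y, B x y = B y x := hs.eq
  obtain ⟨x, y, hxy⟩ := hB
  have he : ∀ z : perp B e f, B e z = 0 := fun z => (mem_perp.1 z.2).1
  have hf : ∀ z : perp B e f, B f z = 0 := fun z => (mem_perp.1 z.2).2
  refine ⟨Matrix.vecCons e fun i => (x i : V), Matrix.vecCons f fun i => (y i : V),
    fun i j => ?_, fun i j => ?_, fun i j => ?_⟩ <;>
  refine Fin.cases ?_ (fun i => ?_) i <;> refine Fin.cases ?_ (fun j => ?_) j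
  · simp [h.left]
  · simp [he]
  · simp [he, hs' _ e]
  · simpa using hxy.left i j
  · simp [h.right]
  · simp [hf]
  · simp [hf, hs' _ f]
  · simpa using hxy.right i j
  · simp [h.dual]
  · simp [he, (Fin.succ_ne_zero j).symm]
  · simp [hf, hs' _ f]
  · simpa using hxy.dual i j

theorem exists_isotropic_of_isAlgClosed [FiniteDimensional K V] [IsAlgClosed K] (hs : B.IsSymm)
    (hd : 2 ≤ finrank K V) : ∃ e, e ≠ 0 ∧ B e e = 0 := by
  have hs' : ∀ x y, B x y = B y x := hs.eq
  let b := finBasis K V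
  let x := b ⟨0, by omega⟩
  let y := b ⟨1, by omega⟩
  by_cases hy : B y y = 0
  · exact ⟨y, b.ne_zero _, hy⟩
  -- The square root of the discriminant of the quadratic form on the span of `x` and `y`.
  obtain ⟨s, hsq⟩ := IsAlgClosed.exists_eq_mul_self (B x y ^ 2 - B x x * B y y)
  refine ⟨B y y • x + (-B x y + s) • y, fun h0 => hy ?_, ?_⟩
  · have := congrArg (fun z => b.repr z ⟨0, by omega⟩) h0
    simpa [x, y, Finsupp.single_apply] using this
  · simp [hs' y x]
    linear_combination B y y * (-hsq)

end Witt

theorem hasHyperbolic_of_isAlgClosed {K : Type*} [Field K] [IsAlgClosed K] (h2 : (2 : K) ≠ 0)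
    (p : ℕ) : ∀ {V : Type*} [AddCommGroup V] [Module K V] [FiniteDimensional K V]
      {B : LinearMap.BilinForm K V}, B.IsSymm → B.Nondegenerate → 2 * p ≤ finrank K V →
      HasHyperbolic B p := by
  induction p with
  | zero =>
    intro V _ _ _ B _ _ _
    exact ⟨Fin.elim0, Fin.elim0, fun i => i.elim0, fun i => i.elim0, fun i => i.elim0⟩
  | succ p ih =>
    intro V _ _ _ B hs hn hd
    obtain ⟨e, he0, he⟩ := exists_isotropic_of_isAlgClosed hs (by omega)
    obtain ⟨f, h⟩ := exists_hypPair hs hn h2 he he0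
    have := h.finrank_perp hs
    exact h.hyperbolic_cons hs (ih (restrict_isSymm hs _) (h.restrict_nondegenerate hs hn)
      (by omega))

/-! ### Cone preserving retracts -/

section Retract

variable {K V W : Type*} [Field K] [AddCommGroup V] [Module K V] [AddCommGroup W] [Module K W]
  {BV : LinearMap.BilinForm K V} {BW : LinearMap.BilinForm K W}

theorem isIGCP_map {c : K} (ι : V →ₗ[K] W) (hι : ∀ x y, BW (ι x) (ι y) = c * BV x y) (k : ℕ) :
    IsIGCP BV BW (exteriorPower.map k ι) := by
  rintro _ ⟨u, hu, rfl⟩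
  exact ⟨ι ∘ u, fun i j => by simp [hι, hu i j], (exteriorPower.map_apply_ιMulti _ _).symm⟩

/-- `⋀^p V` is a retract of `⋀^q W` by cone preserving maps. -/
def IsIGCPRetract (BV : LinearMap.BilinForm K V) (BW : LinearMap.BilinForm K W) (p q : ℕ) : Prop :=
  ∃ (Ψ : ⋀[K]^p V →ₗ[K] ⋀[K]^q W) (Θ : ⋀[K]^q W →ₗ[K] ⋀[K]^p V),
    IsIGCP BV BW Ψ ∧ IsIGCP BW BV Θ ∧ Θ ∘ₗ Ψ = LinearMap.id

theorem isIGCPRetract_of_similitude {c : K} (hc : c ≠ 0) (ι : V ≃ₗ[K] W)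
    (hι : ∀ x y, BW (ι x) (ι y) = c * BV x y) (k : ℕ) : IsIGCPRetract BV BW k k := by
  refine ⟨exteriorPower.map k ι.toLinearMap, exteriorPower.map k ι.symm.toLinearMap,
    isIGCP_map _ hι k, isIGCP_map (c := c⁻¹) _ (fun x y => ?_) k, ?_⟩
  · have := hι (ι.symm x) (ι.symm y)
    simp only [LinearEquiv.apply_symm_apply] at this
    simp [this, hc]
  · rw [← exteriorPower.map_comp]
    simp

end Retract

/-! ### Comparison of spaces of equal dimension -/

section Similitude

variable {K V W : Type*} [Field K] [AddCommGroup V] [Module K V] [FiniteDimensional K V]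
  [AddCommGroup W] [Module K W] [FiniteDimensional K W]
  {BV : LinearMap.BilinForm K V} {BW : LinearMap.BilinForm K W}

theorem exists_isometry_even {p : ℕ} (hV : HasHyperbolic BV p) (hW : HasHyperbolic BW p)
    (hVs : BV.IsSymm) (hWs : BW.IsSymm) (hVd : finrank K V = 2 * p) (hWd : finrank K W = 2 * p) :
    ∃ ι : V ≃ₗ[K] W, ∀ x y, BW (ι x) (ι y) = BV x y := by
  obtain ⟨e, f, h⟩ := hV
  obtain ⟨e', f', h'⟩ := hW
  rcases Nat.eq_zero_or_pos p with rfl | hp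
  · have : Subsingleton V := finrank_zero_iff.1 hVd
    have : Subsingleton W := finrank_zero_iff.1 hWd
    exact ⟨0, fun x y => by simp [Subsingleton.elim x 0]⟩
  have : Nonempty (Fin p) := ⟨⟨0, hp⟩⟩
  let b := basisOfLinearIndependentOfCardEqFinrank (h.linearIndependent hVs)
    (by simp [hVd]; omega)
  let b' := basisOfLinearIndependentOfCardEqFinrank (h'.linearIndependent hWs)
    (by simp [hWd]; omega)
  have hb : ⇑b = Sum.elim e f := coe_basisOfLinearIndependentOfCardEqFinrank _ _
  have hb' : ⇑b' = Sum.elim e' f' := coe_basisOfLinearIndependentOfCardEqFinrank _ _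
  let ι := b.equiv b' (Equiv.refl _)
  have hι : ∀ i, ι (b i) = b' i := fun i => by simp [ι]
  refine ⟨ι, fun x y => ?_⟩
  have key : BW.compl₁₂ ι.toLinearMap ι.toLinearMap = BV := by
    refine LinearMap.ext_basis b b fun i j => ?_
    simp only [LinearMap.compl₁₂_apply, LinearEquiv.coe_coe, hι]
    rw [hb, hb']
    rcases i with i | i <;> rcases j with j | j <;> simp only [Sum.elim_inl, Sum.elim_inr]
    · rw [h.left i j, h'.left i j]
    · rw [h.dual i j, h'.dual i j]
    · rw [h.apply_flip hVs, h'.apply_flip hWs]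
    · rw [h.right i j, h'.right i j]
  exact LinearMap.congr_fun (LinearMap.congr_fun key x) y

/-- The values `B g g` of the anisotropic lines may lie in different square classes, so an isometry
need not exist. Scaling the `e` half of the basis by the ratio `c` gives a similitude, which is
enough because cones ignore scaling of the form. -/
theorem exists_similitude_odd {p : ℕ} (hV : HasHyperbolic BV p) (hW : HasHyperbolic BW p)
    (hVs : BV.IsSymm) (hWs : BW.IsSymm) (hVn : BV.Nondegenerate) (hWn : BW.Nondegenerate)
    (hVd : finrank K V = 2 * p + 1) (hWd : finrank K W = 2 * p + 1) :
    ∃ c : K, c ≠ 0 ∧ ∃ ι : V ≃ₗ[K] W, ∀ x y, BW (ι x) (ι y) = c * BV x y := by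
  obtain ⟨e, f, h⟩ := hV
  obtain ⟨e', f', h'⟩ := hW
  obtain ⟨g, hg, hge, hgf⟩ := h.exists_orthogonal hVs hVn hVd
  obtain ⟨g', hg', hge', hgf'⟩ := h'.exists_orthogonal hWs hWn hWd
  have sV : ∀ x y, BV x y = BV y x := hVs.eq
  have sW : ∀ x y, BW x y = BW y x := hWs.eq
  let b := basisOfLinearIndependentOfCardEqFinrank (h.linearIndependent_snoc hVs hg hge hgf)
    (by simp [hVd]; omega)
  let b' := basisOfLinearIndependentOfCardEqFinrank (h'.linearIndependent_snoc hWs hg' hge' hgf')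
    (by simp [hWd]; omega)
  have hb : ⇑b = Sum.elim (Sum.elim e f) fun _ => g :=
    coe_basisOfLinearIndependentOfCardEqFinrank _ _
  have hb' : ⇑b' = Sum.elim (Sum.elim e' f') fun _ => g' :=
    coe_basisOfLinearIndependentOfCardEqFinrank _ _
  let c := BW g' g' / BV g g
  have hc : c ≠ 0 := div_ne_zero hg' hg
  let w : (Fin p ⊕ Fin p) ⊕ Unit → Kˣ := Sum.elim (Sum.elim (fun _ => Units.mk0 c hc) 1) 1
  let ι := b.equiv (b'.unitsSMul w) (Equiv.refl _)
  have hι : ∀ i, ι (b i) = w i • b' i := fun i => by simp [ι, Basis.unitsSMul_apply]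
  refine ⟨c, hc, ι, fun x y => ?_⟩
  have key : BW.compl₁₂ ι.toLinearMap ι.toLinearMap = c • BV := by
    refine LinearMap.ext_basis b b fun i j => ?_
    simp only [LinearMap.compl₁₂_apply, LinearEquiv.coe_coe, hι, LinearMap.smul_apply]
    rw [hb, hb']
    have l : ∀ i j, BV (e i) (e j) = 0 := h.left
    have r : ∀ i j, BV (f i) (f j) = 0 := h.right
    have d : ∀ i j, BV (e i) (f j) = if i = j then 1 else 0 := h.dual
    have d' := h.apply_flip hVs
    have l' : ∀ i j, BW (e' i) (e' j) = 0 := h'.left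
    have r' : ∀ i j, BW (f' i) (f' j) = 0 := h'.right
    have m : ∀ i j, BW (e' i) (f' j) = if i = j then 1 else 0 := h'.dual
    have m' := h'.apply_flip hWs
    rcases i with (i | i) | i <;> rcases j with (j | j) | j <;>
      simp [w, Units.smul_def, l, r, d, d', l', r', m, m', sV _ g, sW _ g', hge, hgf, hge', hgf']
    simp [c, hg]
  exact LinearMap.congr_fun (LinearMap.congr_fun key x) y

end Similitude

/-- Each step splits a hyperbolic plane off `W` and composes with multiplication by `f` and
contraction with `e`, whose composite is the identity; equal dimensions are handled by a similitude.
-/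
theorem exists_isIGCPRetract {K V : Type*} [Field K] [AddCommGroup V] [Module K V]
    [FiniteDimensional K V] {BV : LinearMap.BilinForm K V} (hVs : BV.IsSymm)
    (hVn : BV.Nondegenerate) (h2 : (2 : K) ≠ 0) {p : ℕ} (hp : 1 ≤ p) (hV : HasHyperbolic BV p)
    {ε : ℕ} (hε : ε ≤ 1) (hVd : finrank K V = 2 * p + ε) (d : ℕ) :
    ∀ {W : Type*} [AddCommGroup W] [Module K W] [FiniteDimensional K W]
      {BW : LinearMap.BilinForm K W}, BW.IsSymm → BW.Nondegenerate → HasHyperbolic BW (p + d) →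
      finrank K W = 2 * (p + d) + ε → IsIGCPRetract BV BW p (p + d) := by
  induction d with
  | zero =>
    intro W _ _ _ BW hWs hWn hW hWd
    obtain rfl | rfl : ε = 0 ∨ ε = 1 := by omega
    · obtain ⟨ι, hι⟩ := exists_isometry_even hV hW hVs hWs hVd hWd
      exact isIGCPRetract_of_similitude one_ne_zero ι (by simpa using hι) p
    · obtain ⟨c, hc, ι, hι⟩ := exists_similitude_odd hV hW hVs hWs hVn hWn hVd hWd
      exact isIGCPRetract_of_similitude hc ι hι p
  | succ d ih =>
    intro W _ _ _ BW hWs hWn hW hWd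
    obtain ⟨e, f, hef⟩ : ∃ e f, HypPair BW e f := by
      obtain ⟨e, f, h⟩ := hW
      exact ⟨e 0, f 0, h.left 0 0, h.right 0 0, by simpa using h.dual 0 0⟩
    obtain ⟨Θ, Ψ, hΘ, hΨ, hΘΨ, -⟩ := hef.exists_contract_wedge hWs hWn (p + d)
    have hfin := hef.finrank_perp hWs
    obtain ⟨Ψ', Θ', hΨ', hΘ', hΘΨ'⟩ := ih (restrict_isSymm hWs (perp BW e f))
      (hef.restrict_nondegenerate hWs hWn) (hef.hasHyperbolic_restrict hWs hWn h2 hW) (by omega)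
    refine ⟨Ψ ∘ₗ Ψ', Θ' ∘ₗ Θ, fun ω hω => hΨ _ (hΨ' _ hω),
      fun ω hω => hΘ' _ (hΘ (by omega) _ hω), ?_⟩
    rw [LinearMap.comp_assoc, ← LinearMap.comp_assoc Ψ' Ψ Θ, hΘΨ, LinearMap.id_comp, hΘΨ']

/-- Cone membership is detected by cone preserving maps to `⋀^q W`. -/
theorem mem_cone_of_forall_isIGCP {K W : Type*} [Field K] (h2 : (2 : K) ≠ 0) [AddCommGroup W]
    [Module K W] [FiniteDimensional K W] {BW : LinearMap.BilinForm K W} (hWs : BW.IsSymm)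
    (hWn : BW.Nondegenerate) {q ε : ℕ} (hε : ε ≤ 1) (hq : q + ε = 4) (hW : HasHyperbolic BW q)
    (hWd : finrank K W = 2 * q + ε) (p : ℕ) :
    ∀ {V : Type*} [AddCommGroup V] [Module K V] [FiniteDimensional K V]
      {BV : LinearMap.BilinForm K V}, BV.IsSymm → BV.Nondegenerate → HasHyperbolic BV p →
      finrank K V = 2 * p + ε → 1 ≤ p → ∀ ω : ⋀[K]^p V,
      (∀ Φ : ⋀[K]^p V →ₗ[K] ⋀[K]^q W, IsIGCP BV BW Φ → Φ ω ∈ cone BW q) → ω ∈ cone BV p := by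
  induction p with
  | zero => intro V _ _ _ BV _ _ _ _ h; omega
  | succ n ih =>
    intro V _ _ _ BV hVs hVn hV hVd hp ω hω
    by_cases hnq : n + 1 ≤ q
    · obtain ⟨d, rfl⟩ := Nat.exists_eq_add_of_le hnq
      obtain ⟨Ψ, Θ, hΨ, hΘ, hΘΨ⟩ := exists_isIGCPRetract hVs hVn h2 hp hV hε hVd d hWs hWn hW hWd
      have := hΘ _ (hω Ψ hΨ)
      rwa [← LinearMap.comp_apply, hΘΨ, LinearMap.id_apply] at this
    -- Precomposing with the contraction `Θ` turns the hypothesis on `ω` into that on `Θ ω`, so `Θ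
    -- ω` lies in the cone by induction; wedging back with `f` gives a pure form that agrees with
    -- `ω` along `e`.
    have hpure : ∀ e, e ≠ 0 → BV e e = 0 → PureAlong BV (toForm BV (n + 1) ω) e := by
      intro e he0 he
      obtain ⟨f, hef⟩ := exists_hypPair hVs hVn h2 he he0
      obtain ⟨Θ, Ψ, hΘ, hΨ, -, hP⟩ := hef.exists_contract_wedge hVs hVn n
      have hfin := hef.finrank_perp hVs
      have hn1 : 1 ≤ n := by omega
      have hmem := ih (restrict_isSymm hVs (perp BV e f)) (hef.restrict_nondegenerate hVs hVn)
        (hef.hasHyperbolic_restrict hVs hVn h2 hV) (by omega) hn1 (Θ ω)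
        (fun Φ hΦ => hω (Φ ∘ₗ Θ) fun ω' hω' => hΦ _ (hΘ hn1 _ hω'))
      obtain ⟨y, hy, hyω⟩ := hΨ _ hmem
      refine hP ω ⟨y, hy, ?_⟩
      rw [hyω, sub_self]
      exact fun _ _ _ _ => rfl
    obtain ⟨f, hf, hωf⟩ : ∃ f : Fin (n + 1) → V, IsoTuple BV f ∧
        toForm BV (n + 1) ω = toForm BV (n + 1) (exteriorPower.ιMulti K (n + 1) f) := by
      obtain rfl | rfl : ε = 0 ∨ ε = 1 := by omega
      · exact exists_ιMulti_of_pureAlong_even (by omega) hVs hVn h2 hVd hV hpure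
      · exact exists_ιMulti_of_pureAlong_odd (by omega) hVs hVn h2 hVd hV hpure
    exact ⟨f, hf, (toForm_injective hVs hVn _ hωf).symm⟩

/-! ### Cone and projective points -/

section ConeScaling

variable {K V : Type*} [Field K] [AddCommGroup V] [Module K V] {B : LinearMap.BilinForm K V}

/-- Degree zero is excluded because there the cone consists of the empty wedge product alone. -/
theorem smul_mem_cone {k : ℕ} (hk : 1 ≤ k) {ω : ⋀[K]^k V} (hω : ω ∈ cone B k) (c : K) :
    c • ω ∈ cone B k := by
  obtain ⟨u, hu, rfl⟩ := hω
  let i : Fin k := ⟨0, hk⟩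
  refine ⟨update u i (c • u i), fun a b => ?_, by
    rw [AlternatingMap.map_update_smul, update_eq_self]⟩
  rcases eq_or_ne a i with rfl | ha <;> rcases eq_or_ne b i with rfl | hb
  · simp [hu]
  · simp [hu, hb]
  · simp [hu, ha]
  · simp [hu, ha, hb]

theorem zero_mem_cone {k : ℕ} (hk : 1 ≤ k) : (0 : ⋀[K]^k V) ∈ cone B k := by
  have : Nonempty (Fin k) := ⟨⟨0, hk⟩⟩
  exact ⟨0, fun i j => by simp, AlternatingMap.map_zero _⟩

theorem mk_mem_grassmannian_iff {k : ℕ} (hk : 1 ≤ k) {ω : ⋀[K]^k V} (h : ω ≠ 0) :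
    Projectivization.mk K ω h ∈ grassmannian B k ↔ ω ∈ cone B k := by
  constructor
  · rintro ⟨ω', hω', h', he⟩
    obtain ⟨c, rfl⟩ := (Projectivization.mk_eq_mk_iff' K ω ω' h h').1 he.symm
    exact smul_mem_cone hk hω' c
  · exact fun hω => ⟨ω, hω, h, rfl⟩

end ConeScaling

/-! ### Equations of the isotropic Grassmannian -/

section Closed

variable {K V : Type*} [Field K] [AddCommGroup V] [Module K V] {B : LinearMap.BilinForm K V}

/-- The coordinate of `ω ∈ ⋀^k V` at a tuple of vectors. -/
noncomputable def coordForm (B : LinearMap.BilinForm K V) {k : ℕ} (t : Fin k → V) :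
    Module.Dual K (⋀[K]^k V) where
  toFun ω := toForm B k ω t
  map_add' _ _ := by simp
  map_smul' _ _ := by simp

/-- The polynomials that express decomposability. -/
noncomputable def pluckerPoly (B : LinearMap.BilinForm K V) {k : ℕ} (t v : Fin k → V) :
    MvPolynomial (Module.Dual K (⋀[K]^k V)) K :=
  MvPolynomial.X (coordForm B t) ^ (k - 1) * MvPolynomial.X (coordForm B v) -
    (Matrix.of fun i j => MvPolynomial.X (coordForm B (update t i (v j)))).det

/-- The polynomials that express isotropy. -/
noncomputable def isotropyPoly (B : LinearMap.BilinForm K V) {k : ℕ} {ι : Type*} [Fintype ι]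
    (b b' : ι → V) (t : Fin k → V) (i j : Fin k) : MvPolynomial (Module.Dual K (⋀[K]^k V)) K :=
  ∑ a, MvPolynomial.X (coordForm B (update t i (b a))) *
    MvPolynomial.X (coordForm B (update t j (b' a)))

theorem pluckerPoly_isHomogeneous {k : ℕ} (hk : 1 ≤ k) (t v : Fin k → V) :
    (pluckerPoly B t v).IsHomogeneous k := by
  refine MvPolynomial.IsHomogeneous.sub ?_ ?_
  · have := ((MvPolynomial.isHomogeneous_X K (coordForm B t)).pow (k - 1)).mul
      (MvPolynomial.isHomogeneous_X K (coordForm B v))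
    rwa [one_mul, Nat.sub_add_cancel hk] at this
  · rw [Matrix.det_apply]
    refine MvPolynomial.IsHomogeneous.sum _ _ _ fun σ _ => ?_
    rw [Units.smul_def, zsmul_eq_mul, ← map_intCast (MvPolynomial.C (R := K))]
    refine MvPolynomial.IsHomogeneous.C_mul ?_ _
    have := MvPolynomial.IsHomogeneous.prod Finset.univ (fun i : Fin k =>
      (Matrix.of fun i j => MvPolynomial.X (R := K) (coordForm B (update t i (v j)))) (σ i) i)
      (fun _ => 1) (fun i _ => MvPolynomial.isHomogeneous_X _ _)
    simpa using this

theorem isotropyPoly_isHomogeneous {k : ℕ} {ι : Type*} [Fintype ι] (b b' : ι → V)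
    (t : Fin k → V) (i j : Fin k) : (isotropyPoly B b b' t i j).IsHomogeneous 2 :=
  MvPolynomial.IsHomogeneous.sum _ _ _ fun _ _ =>
    (MvPolynomial.isHomogeneous_X _ _).mul (MvPolynomial.isHomogeneous_X _ _)

theorem evalAt_pluckerPoly {k : ℕ} (t v : Fin k → V) (ω : ⋀[K]^k V) :
    evalAt (pluckerPoly B t v) ω = toForm B k ω t ^ (k - 1) * toForm B k ω v -
      (Matrix.of fun i j => toForm B k ω (update t i (v j))).det := by
  simp only [evalAt, pluckerPoly, map_sub, map_mul, map_pow, MvPolynomial.eval_X, RingHom.map_det]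
  congr 2
  ext i j
  simp [coordForm]

theorem evalAt_isotropyPoly {k : ℕ} {ι : Type*} [Fintype ι] (b b' : ι → V)
    (t : Fin k → V) (i j : Fin k) (ω : ⋀[K]^k V) : evalAt (isotropyPoly B b b' t i j) ω =
      ∑ a, toForm B k ω (update t i (b a)) * toForm B k ω (update t j (b' a)) := by
  simp [evalAt, isotropyPoly, coordForm]

/-- Cramer's rule: the one-slot functionals of a pure form are represented by adjugate combinations
of its factors, so they inherit isotropy. -/
theorem toForm_ιMulti_update {k : ℕ} (u t : Fin k → V) (i : Fin k) (x : V) :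
    toForm B k (exteriorPower.ιMulti K k u) (update t i x) =
      B (∑ r, (Matrix.of fun i j => B (u i) (t j)).adjugate i r • u r) x := by
  rw [toForm_ιMulti]
  have : (Matrix.of fun r j => B (u r) (update t i x j)) =
      (Matrix.of fun i j => B (u i) (t j)).updateCol i (fun r => B (u r) x) := by
    ext r j
    rcases eq_or_ne j i with rfl | hj
    · simp
    · simp [hj]
  rw [this, ← Matrix.cramer_apply, Matrix.cramer_eq_adjugate_mulVec]
  simp [Matrix.mulVec, dotProduct, LinearMap.sum_apply]

theorem sum_apply_dualBasis (hn : B.Nondegenerate) {ι : Type*} [Fintype ι] [DecidableEq ι]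
    (b : Basis ι K V) (x y : V) :
    ∑ a, B x (B.dualBasis hn b a) * B y (b a) = B x y := by
  conv_rhs => rw [← (B.dualBasis hn b).sum_repr y]
  simp [mul_comm]

theorem evalAt_pluckerPoly_of_mem {k : ℕ} (t v : Fin k → V) {ω : ⋀[K]^k V} (hω : ω ∈ cone B k) :
    evalAt (pluckerPoly B t v) ω = 0 := by
  obtain ⟨u, -, rfl⟩ := hω
  rw [evalAt_pluckerPoly]
  set M := Matrix.of fun i j => B (u i) (t j) with hM
  have : (Matrix.of fun i j => toForm B k (exteriorPower.ιMulti K k u) (update t i (v j))) =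
      M.adjugate * Matrix.of fun i j => B (u i) (v j) := by
    ext i j
    simp [toForm_ιMulti_update, Matrix.mul_apply, LinearMap.sum_apply, hM]
  rw [this, Matrix.det_mul, Matrix.det_adjugate, toForm_ιMulti, toForm_ιMulti, Fintype.card_fin,
    ← hM, sub_self]

theorem evalAt_isotropyPoly_of_mem (hn : B.Nondegenerate) {ι : Type*} [Fintype ι] [DecidableEq ι]
    (b : Basis ι K V) {k : ℕ} (t : Fin k → V) (i j : Fin k) {ω : ⋀[K]^k V} (hω : ω ∈ cone B k) :
    evalAt (isotropyPoly B (B.dualBasis hn b) b t i j) ω = 0 := by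
  obtain ⟨u, hu, rfl⟩ := hω
  simp only [evalAt_isotropyPoly, toForm_ιMulti_update]
  rw [sum_apply_dualBasis]
  simp [LinearMap.sum_apply, hu]

/-- At a tuple `t` where the form of `ω` is nonzero, let `U i` represent its one-slot functionals.
The Plücker-type equations say that `ω`, scaled by the `(k - 1)`-st power of that value, is the
wedge of the `U i`; the isotropy equations say that `B (U i) (U j) = 0`. -/
theorem mem_cone_of_evalAt_eq_zero [FiniteDimensional K V]
    (hs : B.IsSymm) (hn : B.Nondegenerate) {ι : Type*} [Fintype ι]
    [DecidableEq ι] (b : Basis ι K V) {k : ℕ} (hk : 1 ≤ k) {ω : ⋀[K]^k V}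
    (h1 : ∀ t v, evalAt (pluckerPoly B t v) ω = 0)
    (h2 : ∀ t i j, evalAt (isotropyPoly B (B.dualBasis hn b) b t i j) ω = 0) : ω ∈ cone B k := by
  by_cases h0 : toForm B k ω = 0
  · rw [(map_eq_zero_iff _ (toForm_injective hs hn k)).1 h0]
    exact zero_mem_cone hk
  obtain ⟨t, ht⟩ : ∃ t, toForm B k ω t ≠ 0 := by
    by_contra hcon
    push Not at hcon
    exact h0 (AlternatingMap.ext hcon)
  let U : Fin k → V := fun i =>
    (B.toDual hn).symm ((toForm B k ω).toMultilinearMap.toLinearMap t i)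
  have hU : ∀ i v, toForm B k ω (update t i v) = B (U i) v := fun i v =>
    Eq.symm (LinearMap.BilinForm.apply_toDual_symm_apply (hB := hn)
      ((toForm B k ω).toMultilinearMap.toLinearMap t i) v)
  have hUc : exteriorPower.ιMulti K k U ∈ cone B k := by
    refine ⟨U, fun i j => ?_, rfl⟩
    have := h2 t i j
    simp only [evalAt_isotropyPoly, hU] at this
    rwa [sum_apply_dualBasis] at this
  have hω : toForm B k ω t ^ (k - 1) • ω = exteriorPower.ιMulti K k U := by
    apply toForm_injective hs hn
    ext v
    have := h1 t v
    rw [evalAt_pluckerPoly, sub_eq_zero] at this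
    rw [map_smul, AlternatingMap.smul_apply, smul_eq_mul, this, toForm_ιMulti]
    simp only [hU]
  rw [show ω = (toForm B k ω t ^ (k - 1))⁻¹ • exteriorPower.ιMulti K k U by
    rw [← hω, inv_smul_smul₀ (pow_ne_zero _ ht)]]
  exact smul_mem_cone hk hUc _

theorem isDefinedBy_equations_grassmannian [FiniteDimensional K V]
    (hs : B.IsSymm) (hn : B.Nondegenerate) {k : ℕ}
    (hk : 1 ≤ k) : IsDefinedBy (grassmannian B k) (equations (grassmannian B k)) := by
  refine ⟨fun f hf => hf.1, Set.Subset.antisymm (fun x hx f hf => hf.2 x hx) fun x hx => ?_⟩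
  have mem : ∀ f : MvPolynomial (Module.Dual K (⋀[K]^k V)) K, (∃ d : ℕ, f.IsHomogeneous d) →
      (∀ ω ∈ cone B k, evalAt f ω = 0) → f ∈ equations (grassmannian B k) := by
    refine fun f hf h => ⟨hf, fun x hx v hv hvx => h v ?_⟩
    rw [← mk_mem_grassmannian_iff hk hv, hvx]
    exact hx
  induction x using Projectivization.ind with
  | h ω hω =>
    rw [mk_mem_grassmannian_iff hk]
    refine mem_cone_of_evalAt_eq_zero hs hn (finBasis K V) hk (fun t v => ?_) (fun t i j => ?_)
    · exact hx _ (mem _ ⟨k, pluckerPoly_isHomogeneous hk t v⟩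
        fun ω' h' => evalAt_pluckerPoly_of_mem t v h') ω hω rfl
    · exact hx _ (mem _ ⟨2, isotropyPoly_isHomogeneous _ _ t i j⟩
        fun ω' h' => evalAt_isotropyPoly_of_mem hn _ t i j h') ω hω rfl

theorem grassmannian_nonempty {k : ℕ} (hB : HasHyperbolic B k) :
    (grassmannian B k).Nonempty := by
  obtain ⟨e, f, h⟩ := hB
  refine ⟨_, exteriorPower.ιMulti K k e, ⟨e, h.left, rfl⟩, fun h0 => ?_, rfl⟩
  have h1 : toForm B k (exteriorPower.ιMulti K k e) f = 1 := by
    rw [toForm_ιMulti, ← Matrix.det_one (n := Fin k) (R := K)]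
    congr 1
    ext i j
    exact h.dual i j
  rw [h0] at h1
  simp at h1

end Closed

/-! ### Pullbacks of equations, and conclusion -/

theorem evalAt_zero_of_isHomogeneous {K E : Type*} [Field K] [AddCommGroup E] [Module K E]
    {f : MvPolynomial (Module.Dual K E) K} {d : ℕ} (hf : f.IsHomogeneous d) {x : E}
    (hx : evalAt f x = 0) : evalAt f 0 = 0 := by
  rcases Nat.eq_zero_or_pos d with rfl | hd
  · rw [← MvPolynomial.totalDegree_zero_iff_isHomogeneous,
      MvPolynomial.totalDegree_eq_zero_iff_eq_C] at hf
    rw [hf] at hx ⊢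
    simpa [evalAt] using hx
  · have : evalAt f 0 = MvPolynomial.constantCoeff f := by
      simp [evalAt, ← MvPolynomial.eval_zero]
    rw [this, MvPolynomial.constantCoeff_eq]
    exact hf.coeff_eq_zero (by simpa using hd.ne)

theorem isDefinedBy_pullbacks {K V W : Type*} [Field K] [AddCommGroup V] [Module K V]
    [AddCommGroup W] [Module K W] {BV : LinearMap.BilinForm K V} {BW : LinearMap.BilinForm K W}
    {p q : ℕ} (hq : 1 ≤ q) (hne : (grassmannian BW q).Nonempty)
    (hcone : 1 ≤ p → ∀ ω : ⋀[K]^p V,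
      (∀ Φ : ⋀[K]^p V →ₗ[K] ⋀[K]^q W, IsIGCP BV BW Φ → Φ ω ∈ cone BW q) → ω ∈ cone BV p)
    {S : Set (MvPolynomial (Module.Dual K (⋀[K]^q W)) K)}
    (hS : IsDefinedBy (grassmannian BW q) S) :
    IsDefinedBy (grassmannian BV p) (pullbacks BV BW p S) := by
  obtain ⟨hhom, hSX⟩ := hS
  refine ⟨?_, Set.Subset.antisymm ?_ ?_⟩
  · rintro _ ⟨Φ, -, f, hf, rfl⟩
    obtain ⟨d, hd⟩ := hhom f hf
    exact ⟨d, hd.rename_isHomogeneous⟩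
  · rintro _ ⟨ω, hω, h, rfl⟩ _ ⟨Φ, hΦ, f, hf, rfl⟩ v hv hvω
    obtain ⟨c, rfl⟩ := (Projectivization.mk_eq_mk_iff' K v ω hv h).1 hvω
    rw [evalAt_pullback]
    have hmem : Φ (c • ω) ∈ cone BW q := by
      rw [map_smul]; exact smul_mem_cone hq (hΦ ω hω) c
    -- A zero image represents no projective point. There the equation could fail only if it were a
    -- nonzero constant, which is impossible since it vanishes at some point of the nonempty
    -- Grassmannian.
    by_cases h0 : Φ (c • ω) = 0
    · obtain ⟨d, hd⟩ := hhom f hf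
      obtain ⟨x, hx⟩ := hne
      rw [hSX] at hx
      rw [h0]
      exact evalAt_zero_of_isHomogeneous hd (hx f hf x.rep x.rep_nonzero x.mk_rep)
    · have hx := (mk_mem_grassmannian_iff hq h0).2 hmem
      rw [hSX] at hx
      exact hx f hf _ h0 rfl
  · intro x hx
    induction x using Projectivization.ind with
    | h ω hω =>
      -- For `p = 0` the exterior power is a line, and its only projective point is the class of the
      -- empty wedge product.
      rcases Nat.eq_zero_or_pos p with rfl | hp
      · let u : ⋀[K]^0 V := exteriorPower.ιMulti K 0 Fin.elim0
        have hu : ω = exteriorPower.zeroEquiv K V ω • u := by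
          apply (exteriorPower.zeroEquiv K V).injective
          simp [u, exteriorPower.zeroEquiv_ιMulti]
        have hu0 : u ≠ 0 := fun h0 => hω (by rw [hu, h0, smul_zero])
        exact ⟨u, ⟨Fin.elim0, fun i => i.elim0, rfl⟩, hu0,
          ((Projectivization.mk_eq_mk_iff' K ω u hω hu0).2 ⟨_, hu.symm⟩).symm⟩
      rw [mk_mem_grassmannian_iff hp]
      refine hcone hp ω fun Φ hΦ => ?_
      by_cases h0 : Φ ω = 0
      · rw [h0]; exact zero_mem_cone hq
      rw [← mk_mem_grassmannian_iff hq h0, hSX]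
      intro f hf v hv hvω
      obtain ⟨c, rfl⟩ := (Projectivization.mk_eq_mk_iff' K v (Φ ω) hv h0).1 hvω
      rw [← map_smul, ← evalAt_pullback]
      have hc : c • ω ≠ 0 := fun hc => hv (by rw [← map_smul, hc, map_zero])
      exact hx _ ⟨Φ, hΦ, f, hf, rfl⟩ (c • ω) hc
        ((Projectivization.mk_eq_mk_iff' K _ ω hc hω).2 ⟨c, rfl⟩)

theorem hasHyperbolic_of_or {K V : Type*} [Field K] [AddCommGroup V] [Module K V]
    [FiniteDimensional K V] {B : LinearMap.BilinForm K V} (hs : B.IsSymm) (hn : B.Nondegenerate)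
    (h2 : (2 : K) ≠ 0) (hB : IsAlgClosed K ∨ HasMaximalWittIndex B) {p ε : ℕ} (hε : ε ≤ 1)
    (hd : finrank K V = 2 * p + ε) : HasHyperbolic B p := by
  obtain hK | ⟨L, hL, hLd⟩ := hB
  · exact hasHyperbolic_of_isAlgClosed h2 p hs hn (by omega)
  · exact hL.hasHyperbolic hs hn h2 (by omega)

/-- Both parts of the theorem, for spaces of either parity of dimension. -/
theorem universal_equations {K V W : Type*} [Field K] (h2 : (2 : K) ≠ 0)
    [AddCommGroup V] [Module K V] [FiniteDimensional K V]
    {BV : LinearMap.BilinForm K V} (hVs : BV.IsSymm) (hVn : BV.Nondegenerate)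
    (hV : IsAlgClosed K ∨ HasMaximalWittIndex BV)
    [AddCommGroup W] [Module K W] [FiniteDimensional K W]
    {BW : LinearMap.BilinForm K W} (hWs : BW.IsSymm) (hWn : BW.Nondegenerate)
    (hW : IsAlgClosed K ∨ HasMaximalWittIndex BW)
    {p q ε : ℕ} (hε : ε ≤ 1) (hq : q + ε = 4) (hVd : finrank K V = 2 * p + ε)
    (hWd : finrank K W = 2 * q + ε) :
    (1 ≤ p → ∀ ω : ⋀[K]^p V, ω ∈ cone BV p ↔
      ∀ Φ : ⋀[K]^p V →ₗ[K] ⋀[K]^q W, IsIGCP BV BW Φ → Φ ω ∈ cone BW q) ∧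
    IsDefinedBy (grassmannian BW q) (equations (grassmannian BW q)) ∧
    ∀ S : Set (MvPolynomial (Module.Dual K (⋀[K]^q W)) K),
      IsDefinedBy (grassmannian BW q) S →
        IsDefinedBy (grassmannian BV p) (pullbacks BV BW p S) := by
  have hVh := hasHyperbolic_of_or hVs hVn h2 hV hε hVd
  have hWh := hasHyperbolic_of_or hWs hWn h2 hW hε hWd
  have hcone := mem_cone_of_forall_isIGCP h2 hWs hWn hε hq hWh hWd p hVs hVn hVh hVd
  exact ⟨fun hp ω => ⟨fun hω Φ hΦ => hΦ ω hω, hcone hp ω⟩,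
    isDefinedBy_equations_grassmannian hWs hWn (by omega),
    fun S hS => isDefinedBy_pullbacks (by omega) (grassmannian_nonempty hWh) hcone hS⟩

end IsoGr

theorem theorem1p1 {K V W : Type*} [Field K] (hchar : ringChar K ≠ 2)
    [AddCommGroup V] [Module K V] [FiniteDimensional K V]
    (BV : LinearMap.BilinForm K V) (hVs : BV.IsSymm) (hVn : BV.Nondegenerate)
    (hV : IsAlgClosed K ∨ IsoGr.HasMaximalWittIndex BV)
    [AddCommGroup W] [Module K W] [FiniteDimensional K W]
    (BW : LinearMap.BilinForm K W) (hWs : BW.IsSymm) (hWn : BW.Nondegenerate)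
    (hW : IsAlgClosed K ∨ IsoGr.HasMaximalWittIndex BW)
    (p : ℕ) :
    (Module.finrank K V = 2 * p + 1 → Module.finrank K W = 7 →
      (1 ≤ p → ∀ ω : ⋀[K]^p V, ω ∈ IsoGr.cone BV p ↔
        ∀ Φ : ⋀[K]^p V →ₗ[K] ⋀[K]^3 W, IsoGr.IsIGCP BV BW Φ → Φ ω ∈ IsoGr.cone BW 3) ∧
      IsoGr.IsDefinedBy (IsoGr.grassmannian BW 3)
        (IsoGr.equations (IsoGr.grassmannian BW 3)) ∧
      ∀ S : Set (MvPolynomial (Module.Dual K (⋀[K]^3 W)) K),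
        IsoGr.IsDefinedBy (IsoGr.grassmannian BW 3) S →
          IsoGr.IsDefinedBy (IsoGr.grassmannian BV p) (IsoGr.pullbacks BV BW p S)) ∧
    (Module.finrank K V = 2 * p → Module.finrank K W = 8 →
      (1 ≤ p → ∀ ω : ⋀[K]^p V, ω ∈ IsoGr.cone BV p ↔
        ∀ Φ : ⋀[K]^p V →ₗ[K] ⋀[K]^4 W, IsoGr.IsIGCP BV BW Φ → Φ ω ∈ IsoGr.cone BW 4) ∧
      IsoGr.IsDefinedBy (IsoGr.grassmannian BW 4)
        (IsoGr.equations (IsoGr.grassmannian BW 4)) ∧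
      ∀ S : Set (MvPolynomial (Module.Dual K (⋀[K]^4 W)) K),
        IsoGr.IsDefinedBy (IsoGr.grassmannian BW 4) S →
          IsoGr.IsDefinedBy (IsoGr.grassmannian BV p) (IsoGr.pullbacks BV BW p S)) := by
  have h2 : (2 : K) ≠ 0 := Ring.two_ne_zero hchar
  exact ⟨fun hVd hWd => IsoGr.universal_equations (ε := 1) h2 hVs hVn hV hWs hWn hW le_rfl rfl
      hVd hWd,
    fun hVd hWd => IsoGr.universal_equations (ε := 0) h2 hVs hVn hV hWs hWn hW zero_le_one rfl
      hVd hWd⟩
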